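/- Let $n\ge 1$ be an integer and let $C>1$. There is a constant $K\ge 1$, depending only on $C$ and $n$, such that the following holds. Let $M$ be a smooth $n$-manifold, let $F\colon TM\to[0,\infty)$ be a Finsler metric on $M$ (a continuous function, $C^\infty$ off the zero section, with $F(x,\lambda v)=\lambda F(x,v)$ for $\lambda>0$, $F(x,v)=0$ if and only if $v=0$, and positive definite vertical Hessian $\big(\partial^2F^2/\partial v_i\partial v_j\big)$ at every $v\neq 0$; $F$ need not be reversible), and let $g_0$ be a smooth Riemannian metric on $M$ such that $$C^{-1}\le \frac{F(x,v)}{\sqrt{g_0(v,v)}}\le C\qquad\text{for all }x\in M,\ 0\ne v\in T_xM .$$ Let $\pi\colon HM=(TM\smallsetminus 0)/\mathbb R_{>0}\to M$ be the bundle of rays; let $A$ be the Hilbert form of $F$, the $1$-form on $HM$ given by $A_{(x,[v])}(Z)=\frac{d}{d\varepsilon}\big|_{\varepsilon=0}F(x,v+\varepsilon\, d\pi(Z))$; let $X$ be its Reeb field ($A(X)=1$, $i_XdA=0$); and let $\Omega^F$ (a volume form on $M$, defined locally up to sign) and $\alpha^F$ (an $(n-1)$-form on $HM$, determined on vertical vectors)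 be given by $\alpha^F\wedge\pi^*\Omega^F=A\wedge (dA)^{n-1}$ and $\int_{H_xM}\alpha^F=\mathrm{vol}(\mathbb S^{n-1})$ for all $x\in M$. Let $$\Delta^Ff(x)=\frac{n}{\mathrm{vol}(\mathbb S^{n-1})}\int_{H_xM}L_X^2(\pi^*f)\,\alpha^F$$ be the Finsler--Laplacian of $F$, and let $\sigma^F$ be its symbol, i.e. the quadratic form on $T^*M$ given by $\sigma^F_x(p,p)=\tfrac12\Delta^F(\varphi^2)(x)$ for any function $\varphi$ that is smooth near $x$ with $\varphi(x)=0$ and $d\varphi_x=p$. Write $\lVert p\rVert_{\sigma^F}=\sqrt{\sigma^F_x(p,p)}$ and $\lVert p\rVert_{g_0^*}=\sup\{p(v)\mid v\in T_xM,\ g_0(v,v)=1\}$. Then $\sigma^F$ is well defined and, for all $x\in M$ and all $0\ne p\in T_x^*M$, $$C^{-K}\le\frac{\lVert p\rVert_{\sigma^F}}{\lVert p\rVert_{g_0^*}}\le C^{K}.$$ -/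

import Mathlib

open scoped Manifold ContDiff Topology

noncomputable section

namespace Finsler

/-- The model space `ℝⁿ` with `n = d + 1`. -/
abbrev E (d : ℕ) : Type := EuclideanSpace ℝ (Fin (d + 1))

/-! ### Multilinear algebra -/

section Algebra

variable {V : Type*} [AddCommGroup V] [Module ℝ V]

/-- The wedge product of a `k`-form and an `l`-form:
`(a ∧ b)(W) = 1/(k! l!) ∑_σ sgn σ a(W_σ(1), …, W_σ(k)) b(W_σ(k+1), …, W_σ(k+l))`. -/
def wedge {k l : ℕ} (a : V [⋀^Fin k]→ₗ[ℝ] ℝ) (b : V [⋀^Fin l]→ₗ[ℝ] ℝ)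
    (W : Fin (k + l) → V) : ℝ :=
  ((k.factorial : ℝ) * (l.factorial : ℝ))⁻¹ * ∑ σ : Equiv.Perm (Fin (k + l)),
    ((Equiv.Perm.sign σ : ℤ) : ℝ) *
      (a (fun i => W (σ (Fin.castAdd l i))) * b (fun j => W (σ (Fin.natAdd k j))))

/-- The `(2d+1)`-form `θ ∧ η ∧ ⋯ ∧ η` (`d` factors `η`) of a `1`-form `θ` and a `2`-form `η`:
`(θ ∧ η^d)(W) = 1/2^d ∑_σ sgn σ θ(W_σ(0)) η(W_σ(1), W_σ(2)) ⋯ η(W_σ(2d-1), W_σ(2d))`. -/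
def wedgeOnePowTwo (d : ℕ) (θ : V →ₗ[ℝ] ℝ) (η : V [⋀^Fin 2]→ₗ[ℝ] ℝ)
    (W : Fin (d + (d + 1)) → V) : ℝ :=
  ((2 : ℝ) ^ d)⁻¹ * ∑ σ : Equiv.Perm (Fin (d + (d + 1))),
    ((Equiv.Perm.sign σ : ℤ) : ℝ) *
      (θ (W (σ ⟨0, by omega⟩)) * ∏ i : Fin d,
        η ![W (σ ⟨2 * (i : ℕ) + 1, by omega⟩), W (σ ⟨2 * (i : ℕ) + 2, by omega⟩)])

end Algebra

/-! ### Finsler metrics and the Finsler-Laplacian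

`M` is a smooth manifold of dimension `n = d + 1`, `TM` its tangent bundle, `T°M ⊆ TM` the set of
non-zero vectors, `HM = T°M / ℝ₊` the homogenized bundle and `r : T°M → HM` the projection. Objects
on `HM` are represented by their pull-backs under `r`: functions on `HM` are the functions on `T°M`
which are homogeneous of degree `0`, forms on `HM` are represented by their pull-backs to `T°M`,
and a vector field on `HM` by a lift to `T°M` (which is unique up to the radial direction `ker dr`,
along which pull-backs from `HM` do not vary). -/

variable {d : ℕ} {M : Type*} [TopologicalSpace M] [ChartedSpace (E d) M]
  [IsManifold (𝓡 (d + 1)) ∞ M]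

/-- A (smooth) Finsler metric on `M`. Positivity of the quadratic form
`w ↦ d²/dt² F²(x, v + t w)` at `t = 0` says that the vertical Hessian of `F²` at `(x, v)` is
positive definite. -/
structure IsFinslerMetric (F : TangentBundle (𝓡 (d + 1)) M → ℝ) : Prop where
  continuous : Continuous F
  smooth : ContMDiffOn (𝓡 (d + 1)).tangent 𝓘(ℝ, ℝ) ∞ F {q | q.2 ≠ 0}
  homogeneous : ∀ (x : M) (v : TangentSpace (𝓡 (d + 1)) x) (c : ℝ), 0 < c →
    F ⟨x, c • v⟩ = c * F ⟨x, v⟩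
  nonneg : ∀ q, 0 ≤ F q
  eq_zero_iff : ∀ (x : M) (v : TangentSpace (𝓡 (d + 1)) x), F ⟨x, v⟩ = 0 ↔ v = 0
  stronglyConvex : ∀ (x : M) (v w : TangentSpace (𝓡 (d + 1)) x), v ≠ 0 → w ≠ 0 →
    0 < iteratedDeriv 2 (fun t : ℝ => F ⟨x, v + t • w⟩ ^ 2) 0

/-- The differential at `q` of the projection `TM → M`. -/
def dproj (q : TangentBundle (𝓡 (d + 1)) M) :
    TangentSpace (𝓡 (d + 1)).tangent q →L[ℝ] TangentSpace (𝓡 (d + 1)) q.1 :=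
  mfderiv (𝓡 (d + 1)).tangent (𝓡 (d + 1))
    (fun q' : TangentBundle (𝓡 (d + 1)) M => q'.1) q

/-- The vertical vector of `T_{(x,v)}TM` that corresponds to `u ∈ T_xM`. -/
def verticalLift (x : M) (v : E d) : E d →L[ℝ] TangentSpace (𝓡 (d + 1)).tangent
    (⟨x, v⟩ : TangentBundle (𝓡 (d + 1)) M) :=
  mfderiv 𝓘(ℝ, E d) (𝓡 (d + 1)).tangent
    (fun u : E d => (⟨x, u⟩ : TangentBundle (𝓡 (d + 1)) M)) v

/-- The Hilbert form `A_{(x,v)}(Z) = d/dε F(x, v + ε dπ(Z))` at `ε = 0`. -/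
def hilbertForm (F : TangentBundle (𝓡 (d + 1)) M → ℝ) (q : TangentBundle (𝓡 (d + 1)) M) :
    TangentSpace (𝓡 (d + 1)).tangent q →L[ℝ] ℝ :=
  (fderiv ℝ (fun u : E d => F ⟨q.1, u⟩) q.2).comp (dproj q)

/-- The exterior derivative at `q` of a `1`-form on the manifold `TM`: the exterior derivative of
the expression of the form in the preferred chart at `q`. (The tangent space at `q` is, by
definition, the model space via this chart.) -/
def extDerivOneForm
    (θ : ∀ q : TangentBundle (𝓡 (d + 1)) M, TangentSpace (𝓡 (d + 1)).tangent q →L[ℝ] ℝ)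
    (q : TangentBundle (𝓡 (d + 1)) M) :
    TangentSpace (𝓡 (d + 1)).tangent q [⋀^Fin 2]→L[ℝ] ℝ :=
  extDeriv (fun z : E d × E d => ContinuousAlternatingMap.ofSubsingleton ℝ (E d × E d) ℝ (0 : Fin 1)
    ((θ ((extChartAt (𝓡 (d + 1)).tangent q).symm z)).comp
      (mfderiv 𝓘(ℝ, E d × E d) (𝓡 (d + 1)).tangent
        (extChartAt (𝓡 (d + 1)).tangent q).symm z)))
    (extChartAt (𝓡 (d + 1)).tangent q q)

/-- `Z ∈ T_q TM` is a lift of the Reeb field of the Hilbert form: `A(Z) = 1` and `i_Z dA = 0`. -/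
def IsReebVector (F : TangentBundle (𝓡 (d + 1)) M → ℝ) (q : TangentBundle (𝓡 (d + 1)) M)
    (Z : TangentSpace (𝓡 (d + 1)).tangent q) : Prop :=
  hilbertForm F q Z = 1 ∧
    ∀ W : TangentSpace (𝓡 (d + 1)).tangent q, extDerivOneForm (hilbertForm F) q ![Z, W] = 0

/-- The Reeb field `X` of the Hilbert form, i.e. the geodesic field of `F`. -/
def reebField (F : TangentBundle (𝓡 (d + 1)) M → ℝ) (q : TangentBundle (𝓡 (d + 1)) M) :
    TangentSpace (𝓡 (d + 1)).tangent q :=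
  Classical.epsilon (IsReebVector F q)

/-- The Lie derivative `L_X h` of a function `h` along the Reeb field `X`. -/
def lieReeb (F h : TangentBundle (𝓡 (d + 1)) M → ℝ) (q : TangentBundle (𝓡 (d + 1)) M) : ℝ :=
  mfderiv (𝓡 (d + 1)).tangent 𝓘(ℝ, ℝ) h q (reebField F q)

/-- The canonical `(2n-1)`-form `A ∧ (dA)^{n-1}`. -/
def contactForm (F : TangentBundle (𝓡 (d + 1)) M → ℝ) (q : TangentBundle (𝓡 (d + 1)) M)
    (W : Fin (d + (d + 1)) → TangentSpace (𝓡 (d + 1)).tangent q) : ℝ :=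
  wedgeOnePowTwo d (hilbertForm F q).toLinearMap
    (extDerivOneForm (hilbertForm F) q).toAlternatingMap W

/-- The Euclidean volume of the unit sphere `S^{n-1}`. -/
def sphereVolume (d : ℕ) : ℝ :=
  ((MeasureTheory.volume : MeasureTheory.Measure (E d)).toSphere).real Set.univ

/-- For an `(n-1)`-form `β` on `ℝⁿ` and a unit vector `s`, the number `c` such that on `s^⊥` one has
`β = c · vol`, where `vol` is the Euclidean area form of the unit sphere at `s`, oriented by the
outward normal: `c = ∑_j (-1)^j s_j β(e_0, …, ê_j, …, e_{n-1})`. -/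
def sphereDensity (β : (Fin d → E d) → ℝ) (s : E d) : ℝ :=
  ∑ j : Fin (d + 1), (-1 : ℝ) ^ (j : ℕ) * s j *
    β (fun i => EuclideanSpace.single (j.succAbove i) (1 : ℝ))

/-- The integral `∫_{H_xM} h α` of an `(n-1)`-form `h α`: the fiber `H_xM` of rays in `T_xM` is
parametrized by the unit sphere of `T_xM ≅ ℝⁿ` (any other star-shaped hypersurface gives the same
value when `h` is homogeneous of degree `0` and `α` comes from `HM`), with its outward orientation,
and `h α` is restricted to it. -/
def fiberIntegral (x : M) (h : TangentBundle (𝓡 (d + 1)) M → ℝ)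
    (α : ∀ v : E d, TangentSpace (𝓡 (d + 1)).tangent (⟨x, v⟩ : TangentBundle (𝓡 (d + 1)) M)
      [⋀^Fin d]→ₗ[ℝ] ℝ) : ℝ :=
  ∫ s : Metric.sphere (0 : E d) 1,
    h ⟨x, (s : E d)⟩ *
      sphereDensity (fun u => α (s : E d) (fun i => verticalLift x (s : E d) (u i))) (s : E d)
    ∂((MeasureTheory.volume : MeasureTheory.Measure (E d)).toSphere)

/-- The volume element `Ω = Ω^F` at `x` and the angle form `α = α^F` on the fiber over `x`:
`α ∧ π^*Ω = A ∧ (dA)^{n-1}` and `∫_{H_xM} α = vol(S^{n-1})`. These two conditions determine `Ω` and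
the restriction of `α` to vertical vectors; the latter is then automatically the pull-back of a
nowhere zero form on `H_xM`. -/
structure IsVolumeAngle (F : TangentBundle (𝓡 (d + 1)) M → ℝ) (x : M)
    (Ω : TangentSpace (𝓡 (d + 1)) x [⋀^Fin (d + 1)]→ₗ[ℝ] ℝ)
    (α : ∀ v : E d, TangentSpace (𝓡 (d + 1)).tangent (⟨x, v⟩ : TangentBundle (𝓡 (d + 1)) M)
      [⋀^Fin d]→ₗ[ℝ] ℝ) : Prop where
  volume_ne_zero : Ω ≠ 0
  wedge_eq : ∀ v : E d, v ≠ 0 →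
    ∀ W : Fin (d + (d + 1)) →
        TangentSpace (𝓡 (d + 1)).tangent (⟨x, v⟩ : TangentBundle (𝓡 (d + 1)) M),
      wedge (α v) (Ω.compLinearMap (dproj (⟨x, v⟩ : TangentBundle (𝓡 (d + 1)) M)).toLinearMap) W
        = contactForm F ⟨x, v⟩ W
  integral_eq : fiberIntegral x (fun _ => 1) α = sphereVolume d

/-- The angle form `α^F` on the fiber over `x`. -/
def angleForm (F : TangentBundle (𝓡 (d + 1)) M → ℝ) (x : M) :
    ∀ v : E d, TangentSpace (𝓡 (d + 1)).tangent (⟨x, v⟩ : TangentBundle (𝓡 (d + 1)) M)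
      [⋀^Fin d]→ₗ[ℝ] ℝ :=
  Classical.epsilon (fun α => ∃ Ω, IsVolumeAngle F x Ω α)

/-- The Finsler-Laplacian
`Δ^F f (x) = n / vol(S^{n-1}) ∫_{H_xM} L_X² (π^*f) α^F`. -/
def finslerLaplacian (F : TangentBundle (𝓡 (d + 1)) M → ℝ) (f : M → ℝ) (x : M) : ℝ :=
  ((d + 1 : ℕ) : ℝ) / sphereVolume d *
    fiberIntegral x
      (lieReeb F (lieReeb F (fun q : TangentBundle (𝓡 (d + 1)) M => f q.1)))
      (angleForm F x)

/-! ### The symbol and the dual norm -/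

/-- `σ` is the (principal) symbol, as a function `p ↦ σ(p, p)` on `T^*M`, of the second order linear
differential operator `P`: one has `σ_x(dφ_x, dφ_x) = ½ P(φ²)(x)` for every function `φ` which is
smooth near `x` and vanishes at `x`. In local coordinates, if
`P = ∑ a^{ij} ∂_i ∂_j + ∑ b^i ∂_i + c` with `a` symmetric, this means
`σ_x(p, p) = ∑ a^{ij}(x) p_i p_j`. -/
def IsSymbol (P : (M → ℝ) → M → ℝ)
    (σ : ∀ x : M, (TangentSpace (𝓡 (d + 1)) x →L[ℝ] ℝ) → ℝ) : Prop :=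
  ∀ (x : M) (φ : M → ℝ), ContMDiffAt (𝓡 (d + 1)) 𝓘(ℝ, ℝ) ∞ φ x → φ x = 0 →
    σ x (mfderiv (𝓡 (d + 1)) 𝓘(ℝ, ℝ) φ x) = 1 / 2 * P (fun y => φ y ^ 2) x

/-- An operator has at most one symbol. -/
theorem IsSymbol.unique {P : (M → ℝ) → M → ℝ}
    {σ τ : ∀ x : M, (TangentSpace (𝓡 (d + 1)) x →L[ℝ] ℝ) → ℝ}
    (hσ : IsSymbol P σ) (hτ : IsSymbol P τ) : σ = τ := by
  funext x p
  have hφ : ∃ φ : M → ℝ, ContMDiffAt (𝓡 (d + 1)) 𝓘(ℝ, ℝ) ∞ φ x ∧ φ x = 0 ∧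
      mfderiv (𝓡 (d + 1)) 𝓘(ℝ, ℝ) φ x = p := by
    let p' : E d →L[ℝ] ℝ := p
    let ψ : E d → ℝ := fun z => p' z - p' (extChartAt (𝓡 (d + 1)) x x)
    have hψ : ContDiff ℝ ∞ ψ := by fun_prop
    have hc : ContMDiffAt (𝓡 (d + 1)) 𝓘(ℝ, ℝ) ∞ (ψ ∘ extChartAt (𝓡 (d + 1)) x) x :=
      hψ.contMDiff.contMDiffAt.comp x contMDiffAt_extChartAt
    refine ⟨_, hc, by simp [ψ], ?_⟩
    rw [(hc.mdifferentiableAt (by simp)).mfderiv]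
    have he : writtenInExtChartAt (𝓡 (d + 1)) 𝓘(ℝ, ℝ) x (ψ ∘ extChartAt (𝓡 (d + 1)) x)
        =ᶠ[𝓝 (extChartAt (𝓡 (d + 1)) x x)] ψ := by
      filter_upwards [extChartAt_target_mem_nhds (I := 𝓡 (d + 1)) x] with z hz
      simp only [writtenInExtChartAt, Function.comp, extChartAt_model_space_eq_id,
        PartialEquiv.refl_coe, id]
      rw [(extChartAt (𝓡 (d + 1)) x).right_inv hz]
    simp only [ModelWithCorners.range_eq_univ, fderivWithin_univ]
    rw [he.fderiv_eq]
    exact (p'.hasFDerivAt.sub_const _).fderiv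
  obtain ⟨φ, h1, h2, rfl⟩ := hφ
  rw [hσ x φ h1 h2, hτ x φ h1 h2]

/-- The norm on `T_x^*M` dual to the Riemannian metric `g`. -/
def dualNorm (g : Bundle.ContMDiffRiemannianMetric (𝓡 (d + 1)) ∞ (E d)
    (fun x : M => TangentSpace (𝓡 (d + 1)) x)) (x : M)
    (p : TangentSpace (𝓡 (d + 1)) x →L[ℝ] ℝ) : ℝ :=
  sSup {t : ℝ | ∃ v : TangentSpace (𝓡 (d + 1)) x, g.inner x v v = 1 ∧ t = p v}

end Finsler

end

/-! # The symbol of the Finsler-Laplacian is comparable to the dual Riemannian metric -/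

noncomputable section

namespace Finsler

/-! ### Multilinear algebra -/

section

open Equiv

/-! Fix `x`, put `f = F(x, ·)` and `n = d + 1`, and let `q` be the `g₀`-dual norm of a covector `p ≠
0` at `x`. The symbol turns out to be an average in which no derivative of `F` is left.

The Reeb field projects to `v / f(v)`, so if `φ(x) = 0` and `dφ_x = p`, then `L_X²(φ²) = 2 (p(v) /
f(v))²` over `x`; the vertical part of `X` is multiplied by `φ(x)` and drops out
(`lieReeb_lieReeb_sq`). In a chart `A = ∂_v F · dx`, hence `A ∧ (dA)^d` is a constant multiple of
`det (df, D²f, …, D²f) ∧ dx` on vertical vectors (`wedgeOnePowTwo_eq_wedge`,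
`exists_contactForm_eq`). On the unit sphere this determinant is the Jacobian `J` of the polar map
`v ↦ ‖v‖ df_v` (`sphereDensity_angleDet`). The normalization of the angle form removes all
constants, and `σ(p, p) = n ∫ (p / f)² J / ∫ J` over the sphere (`isSymbol_finslerLaplacian`).

Strong convexity makes `J` positive and the polar map a bijection of nonzero vectors onto nonzero
covectors, taking the Euclidean unit ball to the unit ball of the norm dual to `f`. Thus `σ(p, p) /
n` is the mean of `(p(v) / f(v))²` over that dual ball with respect to Lebesgue measure, where `v`
is the preimage of the covector.

Upper bound (`integral_ratio_le`): `|p| ≤ q √g₀ ≤ C q f` pointwise. Lower bound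
(`le_integral_ratio`): the dual ball of `f` lies in the `g₀`-dual ball of radius `C` and contains a
`g₀`-dual ball of radius `1 / (16 C³)` around a positive multiple of `p`, on which `p(v) / f(v) ≥ q
/ (2C)`. This small ball is at least the fraction `(16 C⁴)^(-n)` of the volume. Both bounds depend
only on `C` and `n`, and a positive constant is a power of `C` because `C > 1`. -/

/-- The bijection that lists the odd indices `2i + 1` first and the even indices `2j` last. -/
def interleave (d : ℕ) : Fin d ⊕ Fin (d + 1) ≃ Fin (d + (d + 1)) :=
  Equiv.ofBijective
    (Sum.elim (fun i => ⟨2 * (i : ℕ) + 1, by omega⟩) (fun j => ⟨2 * (j : ℕ), by omega⟩)) <| by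
    rw [Fintype.bijective_iff_injective_and_card]
    refine ⟨?_, by simp⟩
    rintro (i | i) (j | j) h <;>
      simp only [Sum.elim_inl, Sum.elim_inr, Sum.inl.injEq, Sum.inr.injEq,
        reduceCtorEq, Fin.ext_iff] at h ⊢ <;> omega

/-- The sign of the shuffle from the block order to the interleaved order. -/
def shuffleSign (d : ℕ) : ℝ :=
  ((Perm.sign (finSumFinEquiv.symm.trans (interleave d)) : ℤ) : ℝ)

theorem shuffleSign_mul_self (d : ℕ) : shuffleSign d * shuffleSign d = 1 := by
  unfold shuffleSign
  rw [← Int.cast_mul, ← Units.val_mul, Int.units_mul_self]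
  simp

theorem shuffleSign_ne_zero (d : ℕ) : shuffleSign d ≠ 0 := fun h => by
  have := shuffleSign_mul_self d
  rw [h] at this
  simp at this

/-- Substituting `σ ↦ σ ∘ κ`, with `κ` the shuffle from block to interleaved order, multiplies each
sign by `shuffleSign d`, whose square is `1`. -/
theorem sum_perm_interleave {d : ℕ} (G : (Fin d ⊕ Fin (d + 1) → Fin (d + (d + 1))) → ℝ) :
    ∑ σ : Perm (Fin (d + (d + 1))), ((Perm.sign σ : ℤ) : ℝ) * G (fun k => σ (interleave d k)) =
      shuffleSign d * ∑ σ : Perm (Fin (d + (d + 1))),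
        ((Perm.sign σ : ℤ) : ℝ) * G (fun k => σ (finSumFinEquiv k)) := by
  rw [Finset.mul_sum]
  set κ : Perm (Fin (d + (d + 1))) := finSumFinEquiv.symm.trans (interleave d) with hκ
  refine Fintype.sum_equiv (Equiv.mulRight κ) _ _ fun σ => ?_
  have h1 : (fun k => (Equiv.mulRight κ σ) (finSumFinEquiv k)) = fun k => σ (interleave d k) := by
    funext k
    simp [hκ]
  rw [h1]
  have h2 : ((Perm.sign (Equiv.mulRight κ σ) : ℤ) : ℝ) = ((Perm.sign σ : ℤ) : ℝ) * shuffleSign d := by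
    simp [shuffleSign, hκ]
  rw [h2]
  linear_combination (-((Perm.sign σ : ℤ) : ℝ) * G (fun k => σ (interleave d k))) *
    shuffleSign_mul_self d

/-- In an alternating sum the antisymmetrization of a bilinear factor may be replaced by twice the
factor. -/
theorem sum_perm_prod_antisymm {N d : ℕ} (z : Perm (Fin N) → ℝ) (c : Fin N → Fin N → ℝ)
    (l r : Fin d → Fin N) (hl : ∀ i j, l i ≠ r j) (hli : Function.Injective l)
    (hri : Function.Injective r)
    (hz : ∀ σ i, z (σ * Equiv.swap (l i) (r i)) = z σ) (S : Finset (Fin d)) :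
    ∑ σ : Perm (Fin N), ((Perm.sign σ : ℤ) : ℝ) * (z σ * ((∏ i ∈ S,
        (c (σ (l i)) (σ (r i)) - c (σ (r i)) (σ (l i)))) * ∏ i ∈ Sᶜ, c (σ (l i)) (σ (r i)))) =
      2 ^ S.card * ∑ σ : Perm (Fin N), ((Perm.sign σ : ℤ) : ℝ) *
        (z σ * ∏ i, c (σ (l i)) (σ (r i))) := by
  induction S using Finset.induction_on with
  | empty => simp
  | insert i S hi ih =>
    rw [Finset.card_insert_of_notMem hi, pow_succ, mul_comm _ (2 : ℝ), mul_assoc, ← ih]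
    have hc : Sᶜ = insert i (insert i S)ᶜ := by
      ext j
      by_cases hj : j = i <;> simp [hj, hi]
    set T := (insert i S)ᶜ with hT
    have hiT : i ∉ T := by simp [hT]
    set A : Perm (Fin N) → ℝ := fun σ => (∏ i ∈ S,
        (c (σ (l i)) (σ (r i)) - c (σ (r i)) (σ (l i)))) * ∏ i ∈ T, c (σ (l i)) (σ (r i)) with hA
    have hAs : ∀ σ, A (σ * Equiv.swap (l i) (r i)) = A σ := by
      intro σ
      have h1 : ∀ j, j ≠ i → Equiv.swap (l i) (r i) (l j) = l j := fun j hj =>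
        Equiv.swap_apply_of_ne_of_ne (hli.ne hj) (hl _ _)
      have h2 : ∀ j, j ≠ i → Equiv.swap (l i) (r i) (r j) = r j := fun j hj =>
        Equiv.swap_apply_of_ne_of_ne (hl _ _).symm (hri.ne hj)
      simp only [hA, Perm.mul_apply]
      congr 1
      · refine Finset.prod_congr rfl fun j hj => ?_
        have : j ≠ i := fun h => hi (h ▸ hj)
        rw [h1 j this, h2 j this]
      · refine Finset.prod_congr rfl fun j hj => ?_
        have : j ≠ i := fun h => hiT (h ▸ hj)
        rw [h1 j this, h2 j this]
    have e1 : ∀ σ : Perm (Fin N), ((Perm.sign σ : ℤ) : ℝ) * (z σ * ((∏ i ∈ insert i S,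
        (c (σ (l i)) (σ (r i)) - c (σ (r i)) (σ (l i)))) * ∏ i ∈ T, c (σ (l i)) (σ (r i)))) =
        ((Perm.sign σ : ℤ) : ℝ) * (z σ * (c (σ (l i)) (σ (r i)) * A σ)) -
        ((Perm.sign σ : ℤ) : ℝ) * (z σ * (c (σ (r i)) (σ (l i)) * A σ)) := by
      intro σ
      rw [Finset.prod_insert hi]
      simp only [hA]
      ring
    have e2 : ∀ σ : Perm (Fin N), ((Perm.sign σ : ℤ) : ℝ) * (z σ * ((∏ i ∈ S,
        (c (σ (l i)) (σ (r i)) - c (σ (r i)) (σ (l i)))) * ∏ i ∈ Sᶜ, c (σ (l i)) (σ (r i)))) =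
        ((Perm.sign σ : ℤ) : ℝ) * (z σ * (c (σ (l i)) (σ (r i)) * A σ)) := by
      intro σ
      rw [hc, Finset.prod_insert hiT]
      simp only [hA]
      ring
    simp_rw [e1, e2]
    rw [Finset.sum_sub_distrib]
    -- Composing with the transposition of `l i` and `r i` flips the sign of `σ`, exchanges the two
    -- terms of the `i`-th factor and leaves `z` and all other factors alone. So each
    -- antisymmetrized factor contributes a `2`.
    have e3 : ∑ σ : Perm (Fin N), ((Perm.sign σ : ℤ) : ℝ) * (z σ * (c (σ (r i)) (σ (l i)) * A σ)) =
        - ∑ σ : Perm (Fin N), ((Perm.sign σ : ℤ) : ℝ) * (z σ * (c (σ (l i)) (σ (r i)) * A σ)) := by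
      rw [← Finset.sum_neg_distrib]
      refine Fintype.sum_equiv (Equiv.mulRight (Equiv.swap (l i) (r i))) _ _ fun σ => ?_
      simp only [Equiv.coe_mulRight, hz, hAs, Perm.sign_mul, Perm.sign_swap (hl i i),
        Perm.mul_apply, Equiv.swap_apply_left, Equiv.swap_apply_right]
      push_cast
      ring
    rw [e3]
    ring

/-! ### Wedge products and bordered determinants -/

section WedgeForms
variable {V : Type*} [AddCommGroup V] [Module ℝ V]

/-- The `d`-form `U ↦ det (a, b U₁, …, b U_d)`. -/
def borderedDet {d : ℕ} (a : Fin (d + 1) → ℝ) (b : V →ₗ[ℝ] (Fin (d + 1) → ℝ)) :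
    V [⋀^Fin d]→ₗ[ℝ] ℝ :=
  ((Matrix.detRowAlternating : (Fin (d + 1) → ℝ) [⋀^Fin (d + 1)]→ₗ[ℝ] ℝ).curryLeft
    a).compLinearMap b

theorem borderedDet_apply {d : ℕ} (a : Fin (d + 1) → ℝ) (b : V →ₗ[ℝ] (Fin (d + 1) → ℝ))
    (U : Fin d → V) :
    borderedDet a b U = Matrix.det (Matrix.of (Fin.cons a fun i => b (U i))) := by
  simp only [borderedDet, AlternatingMap.compLinearMap_apply, AlternatingMap.curryLeft_apply_apply]
  rfl

/-- The permutation acting by `τ` on the first block of indices and by `ρ` on the last one. -/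
def permBlocks {k l : ℕ} (τ : Perm (Fin k)) (ρ : Perm (Fin l)) : Perm (Fin (k + l)) :=
  finSumFinEquiv.permCongr (Equiv.sumCongr τ ρ)

theorem sign_permBlocks {k l : ℕ} (τ : Perm (Fin k)) (ρ : Perm (Fin l)) :
    Perm.sign (permBlocks τ ρ) = Perm.sign τ * Perm.sign ρ := by
  rw [permBlocks, Perm.sign_permCongr, Perm.sign_sumCongr]

theorem permBlocks_castAdd {k l : ℕ} (τ : Perm (Fin k)) (ρ : Perm (Fin l)) (i : Fin k) :
    permBlocks τ ρ (Fin.castAdd l i) = Fin.castAdd l (τ i) := by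
  simp [permBlocks, Equiv.permCongr_apply]

theorem permBlocks_natAdd {k l : ℕ} (τ : Perm (Fin k)) (ρ : Perm (Fin l)) (j : Fin l) :
    permBlocks τ ρ (Fin.natAdd k j) = Fin.natAdd k (ρ j) := by
  simp [permBlocks, Equiv.permCongr_apply]

/-- The product on the left is the diagonal product of `R Qᵀ`, where `R` has rows `a, b(W_σ)` and
`Q` has rows `π(W_σ)`. Reindexing `σ` by a permutation `ρ` of the last block turns it into the
product along `ρ`, with the sign of `ρ`. Summing over the `(d + 1)!` choices of `ρ` gives `det (R
Qᵀ) = det R · det Q`. -/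
theorem sum_perm_block {d : ℕ} (a : Fin (d + 1) → ℝ) (b π : V →ₗ[ℝ] (Fin (d + 1) → ℝ))
    (W : Fin (d + (d + 1)) → V) :
    ((d + 1).factorial : ℝ) * ∑ σ : Perm (Fin (d + (d + 1))), ((Perm.sign σ : ℤ) : ℝ) *
      ((a ⬝ᵥ π (W (σ (Fin.natAdd d 0)))) * ∏ i : Fin d,
        (b (W (σ (Fin.castAdd (d + 1) i))) ⬝ᵥ π (W (σ (Fin.natAdd d i.succ))))) =
    ∑ σ : Perm (Fin (d + (d + 1))), ((Perm.sign σ : ℤ) : ℝ) *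
      (borderedDet a b (fun i => W (σ (Fin.castAdd (d + 1) i))) *
        (Matrix.detRowAlternating.compLinearMap π) (fun j => W (σ (Fin.natAdd d j)))) := by
  set R : Perm (Fin (d + (d + 1))) → Matrix (Fin (d + 1)) (Fin (d + 1)) ℝ := fun σ =>
    Matrix.of (Fin.cons a fun i => b (W (σ (Fin.castAdd (d + 1) i)))) with hR
  set Q : Perm (Fin (d + (d + 1))) → Matrix (Fin (d + 1)) (Fin (d + 1)) ℝ := fun σ =>
    Matrix.of (fun j => π (W (σ (Fin.natAdd d j)))) with hQ
  have h1 : ∀ σ, (a ⬝ᵥ π (W (σ (Fin.natAdd d 0)))) * ∏ i : Fin d,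
        (b (W (σ (Fin.castAdd (d + 1) i))) ⬝ᵥ π (W (σ (Fin.natAdd d i.succ)))) =
      ∏ j, (R σ * (Q σ).transpose) j j := by
    intro σ
    rw [Fin.prod_univ_succ]
    rfl
  simp_rw [h1]
  have h2 : ∀ ρ : Perm (Fin (d + 1)), ∑ σ : Perm (Fin (d + (d + 1))), ((Perm.sign σ : ℤ) : ℝ) *
      ∏ j, (R σ * (Q σ).transpose) j j = ∑ σ : Perm (Fin (d + (d + 1))), ((Perm.sign σ : ℤ) : ℝ) *
      (((Perm.sign ρ : ℤ) : ℝ) * ∏ j, (R σ * (Q σ).transpose) j (ρ j)) := by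
    intro ρ
    symm
    refine Fintype.sum_equiv (Equiv.mulRight (permBlocks 1 ρ)) _ _ fun σ => ?_
    have hR' : R (σ * permBlocks 1 ρ) = R σ := by
      simp only [hR, Perm.mul_apply, permBlocks_castAdd, Perm.one_apply]
    have hQ' : ∀ j, (R σ * (Q (σ * permBlocks 1 ρ)).transpose) j j =
        (R σ * (Q σ).transpose) j (ρ j) := by
      intro j
      simp only [Matrix.mul_apply, Matrix.transpose_apply, hQ, Matrix.of_apply, Perm.mul_apply,
        permBlocks_natAdd]
    simp only [Equiv.coe_mulRight, hR', hQ', Perm.sign_mul, sign_permBlocks, Perm.sign_one, one_mul]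
    push_cast
    ring
  have h3 : ((d + 1).factorial : ℝ) * ∑ σ : Perm (Fin (d + (d + 1))), ((Perm.sign σ : ℤ) : ℝ) *
      ∏ j, (R σ * (Q σ).transpose) j j = ∑ ρ : Perm (Fin (d + 1)),
      ∑ σ : Perm (Fin (d + (d + 1))), ((Perm.sign σ : ℤ) : ℝ) *
      ∏ j, (R σ * (Q σ).transpose) j j := by
    rw [Finset.sum_const, Finset.card_univ, Fintype.card_perm, Fintype.card_fin, nsmul_eq_mul]
  rw [h3, Finset.sum_congr rfl fun ρ _ => h2 ρ, Finset.sum_comm]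
  refine Finset.sum_congr rfl fun σ _ => ?_
  rw [← Finset.mul_sum]
  congr 1
  rw [borderedDet_apply]
  change _ = (R σ).det * (Q σ).det
  rw [← Matrix.det_transpose (Q σ), ← Matrix.det_mul, ← Matrix.det_transpose, Matrix.det_apply']
  rfl

/-- If `θ = a ∘ π` and `η = b ∧ π`, then `θ ∧ η^d` is a multiple of the wedge product of the form
`det (a, b, …, b)` and the pull-back of the determinant under `π`. -/
theorem wedgeOnePowTwo_eq_wedge {d : ℕ} (a : Fin (d + 1) → ℝ) (b π : V →ₗ[ℝ] (Fin (d + 1) → ℝ))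
    (θ : V →ₗ[ℝ] ℝ) (η : V [⋀^Fin 2]→ₗ[ℝ] ℝ) (hθ : ∀ Z, θ Z = a ⬝ᵥ π Z)
    (hη : ∀ Z Y, η ![Z, Y] = b Z ⬝ᵥ π Y - b Y ⬝ᵥ π Z) (W : Fin (d + (d + 1)) → V) :
    wedgeOnePowTwo d θ η W = shuffleSign d * d.factorial *
      wedge (borderedDet a b) (Matrix.detRowAlternating.compLinearMap π) W := by
  -- In the interleaved order `b` occupies the odd slots and `π` the even ones. Slot `0` carries `θ`
  -- and is not touched by the swaps. The resulting `2 ^ d` cancels the prefactor of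
  -- `wedgeOnePowTwo`.
  have key := sum_perm_prod_antisymm (N := d + (d + 1)) (d := d)
    (fun σ => a ⬝ᵥ π (W (σ (interleave d (Sum.inr 0)))))
    (fun k l => b (W k) ⬝ᵥ π (W l)) (fun i => interleave d (Sum.inl i))
    (fun i => interleave d (Sum.inr i.succ)) (by simp) (fun i j h => by simpa using h)
    (fun i j h => by simpa using h) (fun σ i => by
      have : Equiv.swap (interleave d (Sum.inl i)) (interleave d (Sum.inr i.succ))
          (interleave d (Sum.inr 0)) = interleave d (Sum.inr 0) :=
        Equiv.swap_apply_of_ne_of_ne (by simp) (by simp [(Fin.succ_ne_zero i).symm])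
      simp only [Perm.mul_apply, this]) Finset.univ
  simp only [Finset.compl_univ, Finset.prod_empty, mul_one, Finset.card_univ,
    Fintype.card_fin] at key
  have e1 : wedgeOnePowTwo d θ η W = ((2 : ℝ) ^ d)⁻¹ * ∑ σ : Perm (Fin (d + (d + 1))),
      ((Perm.sign σ : ℤ) : ℝ) * (a ⬝ᵥ π (W (σ (interleave d (Sum.inr 0)))) * ∏ i : Fin d,
        (b (W (σ (interleave d (Sum.inl i)))) ⬝ᵥ π (W (σ (interleave d (Sum.inr i.succ)))) -
          b (W (σ (interleave d (Sum.inr i.succ)))) ⬝ᵥ π (W (σ (interleave d (Sum.inl i)))))) := by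
    simp only [wedgeOnePowTwo, hθ, hη]
    rfl
  rw [e1, key, ← mul_assoc, inv_mul_cancel₀ (by positivity), one_mul]
  have e2 := sum_perm_interleave (d := d) (fun s => a ⬝ᵥ π (W (s (Sum.inr 0))) *
    ∏ i : Fin d, b (W (s (Sum.inl i))) ⬝ᵥ π (W (s (Sum.inr i.succ))))
  rw [e2]
  have e3 := sum_perm_block a b π W
  simp only [finSumFinEquiv_apply_left, finSumFinEquiv_apply_right]
  unfold wedge
  rw [← e3]
  have := (Nat.cast_ne_zero (R := ℝ)).2 (Nat.factorial_ne_zero d)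
  have := (Nat.cast_ne_zero (R := ℝ)).2 (Nat.factorial_ne_zero (d + 1))
  field_simp

/-- A permutation that sends an index of the last block into the first one feeds some `u i` to `γ`
and contributes nothing. The remaining ones preserve both blocks; there are `k! l!` of them, all
with the same contribution. Applied to vertical `u` and `γ` pulled back from the base, this reads
off `α` on vertical vectors. -/
theorem wedge_append {k l : ℕ} (α : V [⋀^Fin k]→ₗ[ℝ] ℝ) (γ : V [⋀^Fin l]→ₗ[ℝ] ℝ)
    (u : Fin k → V) (w : Fin l → V) (h : ∀ (Y : Fin l → V) i j, Y j = u i → γ Y = 0) :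
    wedge α γ (Fin.append u w) = α u * γ w := by
  have hinj : Function.Injective
      (fun p : Perm (Fin k) × Perm (Fin l) => permBlocks p.1 p.2) := by
    rintro ⟨τ, ρ⟩ ⟨τ', ρ'⟩ hp
    simp only at hp
    refine Prod.ext (Equiv.ext fun i => ?_) (Equiv.ext fun j => ?_)
    · have := congrArg (fun σ => σ (Fin.castAdd l i)) hp
      simpa [permBlocks_castAdd] using this
    · have := congrArg (fun σ => σ (Fin.natAdd k j)) hp
      simpa [permBlocks_natAdd] using this
  have hsum : ∑ σ : Perm (Fin (k + l)), ((Perm.sign σ : ℤ) : ℝ) *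
      (α (fun i => Fin.append u w (σ (Fin.castAdd l i))) *
        γ (fun j => Fin.append u w (σ (Fin.natAdd k j)))) =
      ∑ p : Perm (Fin k) × Perm (Fin l), α u * γ w := by
    symm
    refine Finset.sum_of_injOn (fun p : Perm (Fin k) × Perm (Fin l) => permBlocks p.1 p.2)
      hinj.injOn (by simp) ?_ ?_
    · intro σ _ hσ
      have : γ (fun j => Fin.append u w (σ (Fin.natAdd k j))) = 0 := by
        by_contra hne
        apply hσ
        have hm : ∀ j, ∃ j', σ (Fin.natAdd k j) = Fin.natAdd k j' := by
          intro j
          induction hj : σ (Fin.natAdd k j) using Fin.addCases with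
          | left i =>
            exact absurd (h _ i j (by simp [hj])) hne
          | right j' => exact ⟨j', rfl⟩
        choose ρ hρ using hm
        have hρi : Function.Injective ρ := fun i j hij => by
          have : σ (Fin.natAdd k i) = σ (Fin.natAdd k j) := by rw [hρ, hρ, hij]
          simpa using this
        have hρb := Finite.injective_iff_bijective.1 hρi
        have hm' : ∀ i, ∃ i', σ (Fin.castAdd l i) = Fin.castAdd l i' := by
          intro i
          induction hj : σ (Fin.castAdd l i) using Fin.addCases with
          | left i' => exact ⟨i', rfl⟩
          | right j' =>
            obtain ⟨j, rfl⟩ := hρb.2 j'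
            rw [← hρ] at hj
            have := congrArg Fin.val (σ.injective hj)
            simp only [Fin.val_castAdd, Fin.val_natAdd] at this
            omega
        choose τ hτ using hm'
        have hτi : Function.Injective τ := fun i j hij => by
          have : σ (Fin.castAdd l i) = σ (Fin.castAdd l j) := by rw [hτ, hτ, hij]
          simpa using this
        refine ⟨(Equiv.ofBijective τ (Finite.injective_iff_bijective.1 hτi),
          Equiv.ofBijective ρ hρb), by simp, Equiv.ext fun m => ?_⟩
        induction m using Fin.addCases with
        | left i => simp [permBlocks_castAdd, hτ]
        | right j => simp [permBlocks_natAdd, hρ]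
      rw [this]
      simp
    · rintro ⟨τ, ρ⟩ _
      simp only [permBlocks_castAdd, permBlocks_natAdd, Fin.append_left, Fin.append_right,
        sign_permBlocks]
      have h1 := α.map_perm u τ
      have h2 := γ.map_perm w ρ
      simp only [Function.comp_def] at h1 h2
      rw [h1, h2]
      rcases Int.units_eq_one_or (Perm.sign τ) with h | h <;>
        rcases Int.units_eq_one_or (Perm.sign ρ) with h' | h' <;> simp [h, h']
  unfold wedge
  rw [hsum, Finset.sum_const, Finset.card_univ, Fintype.card_prod, Fintype.card_perm,
    Fintype.card_perm, Fintype.card_fin, Fintype.card_fin, nsmul_eq_mul]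
  have := (Nat.cast_ne_zero (R := ℝ)).2 (Nat.factorial_ne_zero k)
  have := (Nat.cast_ne_zero (R := ℝ)).2 (Nat.factorial_ne_zero l)
  push_cast
  field_simp

/-- Expansion of the determinant of a rank one perturbation of a singular matrix. -/
theorem sum_mul_det_cons_succAbove {d : ℕ} (H : Matrix (Fin (d + 1)) (Fin (d + 1)) ℝ)
    (hH : H.det = 0) (s a : Fin (d + 1) → ℝ) :
    ∑ j : Fin (d + 1), (-1 : ℝ) ^ (j : ℕ) * s j *
      Matrix.det (Matrix.of (Fin.cons a fun i => H (j.succAbove i))) =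
      (H + Matrix.vecMulVec s a).det := by
  -- `B` is the block matrix `(1, -a; s, H)`. Its Schur complement is `H + s aᵀ`; expanding along
  -- the first column gives the sum on the left, plus `det H = 0`.
  set B : Matrix (Fin (d + 1 + 1)) (Fin (d + 1 + 1)) ℝ :=
    Matrix.of (Fin.cons (Fin.cons 1 (-a)) fun i => Fin.cons (s i) (H i)) with hB
  have h1 : B.det = (H + Matrix.vecMulVec s a).det := by
    have h2 : (B.submatrix (finSumFinEquiv.trans (finCongr (add_comm 1 (d + 1))))
        (finSumFinEquiv.trans (finCongr (add_comm 1 (d + 1))))) = Matrix.fromBlocks 1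
          (Matrix.replicateRow (Fin 1) (-a)) (Matrix.replicateCol (Fin 1) s) H := by
      have e0 : ∀ i : Fin 1, (finSumFinEquiv.trans (finCongr (add_comm 1 (d + 1))))
        (Sum.inl i) = 0 := by
        intro i; ext; simp
      have e1 : ∀ i : Fin (d + 1), (finSumFinEquiv.trans (finCongr (add_comm 1 (d + 1))))
        (Sum.inr i) = i.succ := by
        intro i; ext; simp
      ext (i | i) (j | j) <;>
        simp only [Matrix.submatrix_apply, e0, e1, hB, Matrix.of_apply, Fin.cons_zero, Fin.cons_succ,
          Matrix.fromBlocks_apply₁₁, Matrix.fromBlocks_apply₁₂, Matrix.fromBlocks_apply₂₁,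
          Matrix.fromBlocks_apply₂₂, Matrix.replicateRow_apply, Matrix.replicateCol_apply]
      rw [Subsingleton.elim i j, Matrix.one_apply_eq]
    rw [← Matrix.det_submatrix_equiv_self (finSumFinEquiv.trans (finCongr (add_comm 1 (d + 1)))) B,
      h2, Matrix.det_fromBlocks_one₁₁]
    congr 1
    ext i j
    simp [Matrix.mul_apply, Matrix.vecMulVec_apply]
  rw [← h1]
  symm
  rw [Matrix.det_succ_column_zero, Fin.sum_univ_succ]
  have h0 : (B.submatrix (Fin.succAbove 0) Fin.succ) = H := by
    ext i j
    simp [hB]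
  rw [h0, hH, mul_zero, zero_add]
  refine Finset.sum_congr rfl fun j _ => ?_
  have h3 : (B.submatrix (j.succ.succAbove) Fin.succ) =
      Matrix.updateRow (Matrix.of (Fin.cons a fun i => H (j.succAbove i))) 0 ((-1 : ℝ) • a) := by
    ext i k
    induction i using Fin.cases with
    | zero => simp [hB]
    | succ i => simp [hB, Fin.succ_succAbove_succ, Matrix.updateRow_ne]
  rw [h3, Matrix.det_updateRow_smul]
  have h4 : Matrix.updateRow (Matrix.of (Fin.cons a fun i => H (j.succAbove i))) 0 a =
    Matrix.of (Fin.cons a fun i => H (j.succAbove i)) := by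
    ext i k
    induction i using Fin.cases with
    | zero => simp
    | succ i => simp [Matrix.updateRow_ne]
  rw [h4]
  simp [hB, pow_succ]
end WedgeForms

end

/-! ### Minkowski norms -/

section

/-- The matrix `G = c H + a aᵀ` is positive definite and `c (H + s aᵀ) = G + (c s - a) aᵀ`. From `H
s = 0` one gets `aᵀ G⁻¹ = c⁻¹ sᵀ`, so the correction factor in the matrix determinant lemma is `1 +
c⁻¹ (c s·s - s·a) = 1`. Hence the determinant sought is a positive multiple of `det G`. -/
theorem det_add_vecMulVec_pos {n : Type*} [Fintype n] [DecidableEq n] (H : Matrix n n ℝ)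
    (s a : n → ℝ) (c : ℝ) (hc : 0 < c) (hH : H.IsSymm) (hs : H.mulVec s = 0) (has : a ⬝ᵥ s = c)
    (hss : s ⬝ᵥ s = 1) (hpos : ∀ w, w ≠ 0 → 0 < (a ⬝ᵥ w) ^ 2 + c * (w ⬝ᵥ H.mulVec w)) :
    0 < (H + Matrix.vecMulVec s a).det := by
  set G : Matrix n n ℝ := c • H + Matrix.vecMulVec a a with hG
  have hGpos : G.PosDef := by
    rw [Matrix.posDef_iff_dotProduct_mulVec]
    constructor
    · ext i j
      simp [hG, Matrix.vecMulVec_apply, hH.apply i j, mul_comm]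
    · intro w hw
      have := hpos w hw
      simp only [hG, Matrix.add_mulVec, Matrix.smul_mulVec, dotProduct_add, dotProduct_smul,
        Matrix.vecMulVec_mulVec, star_trivial, smul_eq_mul, op_smul_eq_smul]
      rw [dotProduct_comm w a]
      linarith [this, sq (a ⬝ᵥ w)]
  have hdet := hGpos.det_pos
  have hsG : Matrix.vecMul s G = c • a := by
    rw [hG, Matrix.vecMul_add, Matrix.vecMul_smul, Matrix.vecMul_vecMulVec, dotProduct_comm s a, has,
      ← Matrix.mulVec_transpose, hH.eq, hs]
    simp
  have haG : Matrix.vecMul a G⁻¹ = c⁻¹ • s := by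
    have h1 : a = c⁻¹ • Matrix.vecMul s G := by rw [hsG, smul_smul, inv_mul_cancel₀ hc.ne', one_smul]
    rw [h1, Matrix.smul_vecMul, Matrix.vecMul_vecMul, Matrix.mul_nonsing_inv _ hdet.ne'.isUnit,
      Matrix.vecMul_one]
  have key := Matrix.det_add_replicateCol_mul_replicateRow (ι := Unit) hdet.ne'.isUnit (c • s - a) a
  have h2 : G + Matrix.replicateCol Unit (c • s - a) * Matrix.replicateRow Unit a =
      c • (H + Matrix.vecMulVec s a) := by
    ext i j
    simp [hG, Matrix.mul_apply, Matrix.vecMulVec_apply]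
    ring
  have h3 : (1 + Matrix.replicateRow Unit a * G⁻¹ * Matrix.replicateCol Unit (c • s - a)) = 1 := by
    have : Matrix.replicateRow Unit a * G⁻¹ = Matrix.replicateRow Unit (c⁻¹ • s) := by
      rw [← haG, Matrix.replicateRow_vecMul]
    rw [this]
    ext i j
    simp only [Matrix.add_apply, Matrix.replicateRow_mul_replicateCol_apply, smul_dotProduct,
      dotProduct_sub, dotProduct_smul, hss, dotProduct_comm s a, has]
    simp only [smul_eq_mul]
    ring
  rw [h2, h3, Matrix.det_one, mul_one, Matrix.det_smul] at key
  have : 0 < c ^ Fintype.card n := by positivity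
  exact (pos_iff_pos_of_mul_pos (key ▸ hdet)).1 this

/-- A (not necessarily reversible) smooth and strongly convex norm on `ℝⁿ`. -/
structure IsMinkowskiNorm {d : ℕ} (f : E d → ℝ) : Prop where
  smooth : ContDiffOn ℝ ∞ f {0}ᶜ
  homogeneous : ∀ (v : E d) (c : ℝ), 0 < c → f (c • v) = c * f v
  pos : ∀ v, v ≠ 0 → 0 < f v
  stronglyConvex : ∀ v w, v ≠ 0 → w ≠ 0 → 0 < iteratedDeriv 2 (fun t : ℝ => f (v + t • w) ^ 2) 0

namespace IsMinkowskiNorm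

variable {d : ℕ} {f : E d → ℝ} (hf : IsMinkowskiNorm f)
include hf

theorem contDiffAt {v : E d} (hv : v ≠ 0) : ContDiffAt ℝ ∞ f v :=
  hf.smooth.contDiffAt (isOpen_compl_singleton.mem_nhds hv)

theorem differentiableAt {v : E d} (hv : v ≠ 0) : DifferentiableAt ℝ f v :=
  (hf.contDiffAt hv).differentiableAt (by simp)

theorem differentiableAt_fderiv {v : E d} (hv : v ≠ 0) : DifferentiableAt ℝ (fderiv ℝ f) v :=
  ((hf.contDiffAt hv).fderiv_right (m := ∞) (by simp)).differentiableAt (by simp)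

theorem map_zero : f 0 = 0 := by
  have := hf.homogeneous 0 2 (by norm_num)
  rw [smul_zero] at this
  linarith

theorem nonneg (v : E d) : 0 ≤ f v := by
  by_cases hv : v = 0
  · rw [hv, hf.map_zero]
  · exact (hf.pos v hv).le

theorem fderiv_smul (v : E d) {c : ℝ} (hc : 0 < c) : fderiv ℝ f (c • v) = fderiv ℝ f v := by
  have h1 := fderiv_comp_smul (f := f) (x := v) c
  have h2 : (fun x => f (c • x)) = c • f := by
    funext x
    simp [hf.homogeneous x c hc]
  rw [h2, fderiv_const_smul_field] at h1
  exact (smul_right_injective _ hc.ne' h1).symm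

/-- Euler's identity. -/
theorem fderiv_self {v : E d} (hv : v ≠ 0) : fderiv ℝ f v v = f v := by
  have h1 : HasDerivAt (fun t : ℝ => f (t • v)) (fderiv ℝ f v v) 1 := by
    have hd : HasFDerivAt f (fderiv ℝ f v) ((1 : ℝ) • v) := by
      rw [one_smul]; exact (hf.differentiableAt hv).hasFDerivAt
    have := hd.comp_hasDerivAt (1 : ℝ) ((hasDerivAt_id (1 : ℝ)).smul_const v)
    rw [one_smul] at this
    exact this
  have h2 : HasDerivAt (fun t : ℝ => f (t • v)) (f v) 1 := by
    have := (hasDerivAt_id (1 : ℝ)).mul_const (f v)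
    rw [one_mul] at this
    refine this.congr_of_eventuallyEq ?_
    filter_upwards [lt_mem_nhds (zero_lt_one' ℝ)] with t ht
    exact hf.homogeneous v t ht
  exact h1.unique h2

theorem hess_symm {v : E d} (hv : v ≠ 0) (u w : E d) :
    fderiv ℝ (fderiv ℝ f) v u w = fderiv ℝ (fderiv ℝ f) v w u :=
  ((hf.contDiffAt hv).isSymmSndFDerivAt
    (by rw [minSmoothness_of_isRCLikeNormedField]; exact WithTop.coe_le_coe.2 le_top)).eq u w

theorem hess_self {v : E d} (hv : v ≠ 0) : fderiv ℝ (fderiv ℝ f) v v = 0 := by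
  have h1 : HasDerivAt (fun t : ℝ => fderiv ℝ f (t • v)) (fderiv ℝ (fderiv ℝ f) v v) 1 := by
    have hd : HasFDerivAt (fderiv ℝ f) (fderiv ℝ (fderiv ℝ f) v) ((1 : ℝ) • v) := by
      rw [one_smul]; exact (hf.differentiableAt_fderiv hv).hasFDerivAt
    have := hd.comp_hasDerivAt (1 : ℝ) ((hasDerivAt_id (1 : ℝ)).smul_const v)
    rw [one_smul] at this
    exact this
  have h2 : HasDerivAt (fun t : ℝ => fderiv ℝ f (t • v)) 0 1 := by
    refine (hasDerivAt_const (1 : ℝ) (fderiv ℝ f v)).congr_of_eventuallyEq ?_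
    filter_upwards [lt_mem_nhds (zero_lt_one' ℝ)] with t ht
    exact hf.fderiv_smul v ht
  exact h1.unique h2

theorem hess_apply_self {v : E d} (hv : v ≠ 0) (u : E d) :
    fderiv ℝ (fderiv ℝ f) v u v = 0 := by
  rw [hf.hess_symm hv, hf.hess_self hv]
  rfl

omit hf in
theorem hasDerivAt_line (v w : E d) (t : ℝ) : HasDerivAt (fun t : ℝ => v + t • w) w t := by
  simpa using ((hasDerivAt_id t).smul_const w).const_add v

theorem hasDerivAt_sq_line {v w : E d} {t : ℝ} (h : v + t • w ≠ 0) :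
    HasDerivAt (fun t : ℝ => f (v + t • w) ^ 2)
      (2 * (f (v + t • w) * fderiv ℝ f (v + t • w) w)) t := by
  have := ((hf.differentiableAt h).hasFDerivAt.comp_hasDerivAt t (hasDerivAt_line v w t)).pow 2
  refine this.congr_deriv ?_
  simp only [Function.comp_apply, Nat.cast_ofNat, Nat.add_one_sub_one, pow_one]
  ring

theorem hasDerivAt_deriv_sq_line {v w : E d} {t : ℝ} (h : v + t • w ≠ 0) :
    HasDerivAt (fun t : ℝ => 2 * (f (v + t • w) * fderiv ℝ f (v + t • w) w))
      (2 * ((fderiv ℝ f (v + t • w) w) ^ 2 +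
        f (v + t • w) * fderiv ℝ (fderiv ℝ f) (v + t • w) w w)) t := by
  have h1 := (hf.differentiableAt h).hasFDerivAt.comp_hasDerivAt t (hasDerivAt_line v w t)
  have h2 := (hf.differentiableAt_fderiv h).hasFDerivAt.comp_hasDerivAt t (hasDerivAt_line v w t)
  have h3 := h2.clm_apply (hasDerivAt_const t w)
  have := (h1.mul h3).const_mul 2
  refine this.congr_deriv ?_
  simp only [Function.comp_apply, _root_.map_zero, add_zero]
  ring

theorem hess_pos {v w : E d} (hv : v ≠ 0) (hw : w ≠ 0) :
    0 < (fderiv ℝ f v w) ^ 2 + f v * fderiv ℝ (fderiv ℝ f) v w w := by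
  have h := hf.stronglyConvex v w hv hw
  rw [iteratedDeriv_succ, iteratedDeriv_one] at h
  have hev : ∀ᶠ t : ℝ in 𝓝 0, v + t • w ≠ 0 := by
    have hc : ContinuousAt (fun t : ℝ => v + t • w) 0 := (hasDerivAt_line v w 0).continuousAt
    exact hc.eventually_ne (by simpa using hv)
  have h0 : v + (0 : ℝ) • w ≠ 0 := by simpa using hv
  have he : deriv (fun t : ℝ => f (v + t • w) ^ 2) =ᶠ[𝓝 0]
      fun t : ℝ => 2 * (f (v + t • w) * fderiv ℝ f (v + t • w) w) := by
    filter_upwards [hev] with t ht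
    exact (hf.hasDerivAt_sq_line ht).deriv
  rw [he.deriv_eq, (hf.hasDerivAt_deriv_sq_line h0).deriv] at h
  simp only [zero_smul, add_zero] at h
  linarith

/-- If `w` is in the kernel, so is `w - (df_v(w) / f(v)) v`, on which `df_v` vanishes as well;
`hess_pos` then forces this vector to be `0`. -/
theorem hess_eq_zero_iff {v w : E d} (hv : v ≠ 0) :
    fderiv ℝ (fderiv ℝ f) v w = 0 ↔ ∃ c : ℝ, w = c • v := by
  constructor
  · intro h
    refine ⟨fderiv ℝ f v w / f v, ?_⟩
    by_contra hne
    have hne' : w - (fderiv ℝ f v w / f v) • v ≠ 0 := sub_ne_zero.2 hne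
    have := hf.hess_pos hv hne'
    have e : fderiv ℝ (fderiv ℝ f) v (w - (fderiv ℝ f v w / f v) • v) = 0 := by
      rw [map_sub, map_smul, hf.hess_self hv, h]
      simp
    rw [e, map_sub, map_smul, hf.fderiv_self hv, smul_eq_mul,
      div_mul_cancel₀ _ (hf.pos v hv).ne'] at this
    simp at this
  · rintro ⟨c, rfl⟩
    rw [map_smul, hf.hess_self hv, smul_zero]

/-- The fundamental inequality, for vectors of the same norm. -/
theorem fderiv_lt_of_eq {v w : E d} (hw : w ≠ 0) (hfvw : f v = f w)
    (hne : v ≠ w) (hv : v ≠ 0) : fderiv ℝ f v w < f w := by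
  -- A line through the origin leaves the domain of smoothness; there `w` is a multiple of `v` and
  -- homogeneity decides.
  by_cases hseg : ∃ t : ℝ, v + t • (w - v) = 0
  · obtain ⟨t, ht⟩ := hseg
    have ht0 : t ≠ 0 := by rintro rfl; simp [hv] at ht
    have hw' : w = (1 - t⁻¹) • v := by
      have : t • w = (t - 1) • v := by
        rw [smul_sub] at ht
        rw [sub_smul, one_smul]
        linear_combination (norm := module) ht
      calc w = t⁻¹ • (t • w) := by rw [smul_smul, inv_mul_cancel₀ ht0, one_smul]
        _ = _ := by rw [this, smul_smul]; congr 1; field_simp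
    set c := 1 - t⁻¹ with hc
    rw [hw', map_smul, hf.fderiv_self hv, smul_eq_mul]
    rcases lt_trichotomy c 0 with h | h | h
    · exact lt_of_lt_of_le (mul_neg_of_neg_of_pos h (hf.pos v hv)) (hf.nonneg _)
    · exact absurd (by rw [hw', h, zero_smul]) hw
    · exfalso
      rw [hw', hf.homogeneous v c h] at hfvw
      have : c = 1 := by
        have := hf.pos v hv
        field_simp at hfvw
        linarith
      exact hne (by rw [hw', this, one_smul])
  · push Not at hseg
    set h : ℝ → ℝ := fun t => f (v + t • (w - v)) ^ 2 with hh
    set h' : ℝ → ℝ := fun t => 2 * (f (v + t • (w - v)) * fderiv ℝ f (v + t • (w - v)) (w - v))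
      with hh'
    have d1 : ∀ t, HasDerivAt h (h' t) t := fun t => hf.hasDerivAt_sq_line (hseg t)
    have d2 := fun t => hf.hasDerivAt_deriv_sq_line (hseg t)
    -- `h = f²` takes equal values at the ends of the segment, so `h'(c) = 0` for some interior `c`.
    -- A second use of the mean value theorem and `h'' > 0` give `h'(0) < 0`, which is the claim.
    obtain ⟨c, hc, hc'⟩ := exists_hasDerivAt_eq_slope h h' (zero_lt_one' ℝ)
      (fun t _ => (d1 t).continuousAt.continuousWithinAt) (fun t _ => d1 t)
    obtain ⟨e, he, he'⟩ := exists_hasDerivAt_eq_slope h' _ hc.1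
      (fun t _ => (d2 t).continuousAt.continuousWithinAt) (fun t _ => d2 t)
    have hp := hf.hess_pos (hseg e) (sub_ne_zero.2 hne.symm)
    have h1 : h' 0 < h' c := by
      have : 0 < (h' c - h' 0) / (c - 0) := by rw [← he']; linarith
      have := (div_pos_iff_of_pos_right (by simpa using hc.1)).1 this
      linarith
    have h2 : h' c = 0 := by
      rw [hc']
      simp [hh, hfvw]
    have h3 : h' 0 = 2 * (f v * (fderiv ℝ f v w - f v)) := by
      simp [hh', map_sub, hf.fderiv_self hv]
    rw [h2, h3] at h1
    have : fderiv ℝ f v w - f v < 0 := by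
      by_contra hcon
      push Not at hcon
      have := mul_nonneg (hf.nonneg v) hcon
      linarith
    linarith

/-- Rescaling `w` to the `f`-norm of `v` reduces this to `fderiv_lt_of_eq`. In other words, every
`df_v` lies in the unit ball of the norm dual to `f`. -/
theorem fderiv_le {v : E d} (hv : v ≠ 0) (w : E d) : fderiv ℝ f v w ≤ f w := by
  by_cases hw : w = 0
  · simp [hw, hf.map_zero]
  set c := f v / f w with hc
  have hfv := hf.pos v hv
  have hfw := hf.pos w hw
  have hc0 : 0 < c := by positivity
  have hcw : c • w ≠ 0 := smul_ne_zero hc0.ne' hw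
  have hfc : f v = f (c • w) := by
    rw [hf.homogeneous w c hc0, hc]
    field_simp
  by_cases h : v = c • w
  · rw [h, hf.fderiv_smul w hc0, hf.fderiv_self hw]
  · have := hf.fderiv_lt_of_eq hcw hfc h hv
    rw [map_smul, hf.homogeneous w c hc0, smul_eq_mul] at this
    exact (lt_of_mul_lt_mul_left this hc0.le).le

/-- The derivative determines the ray. -/
theorem eq_of_fderiv_eq {v w : E d} (hv : v ≠ 0) (hw : w ≠ 0) (hn : ‖v‖ = ‖w‖)
    (h : fderiv ℝ f v = fderiv ℝ f w) : v = w := by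
  set c := f v / f w with hc
  have hfv := hf.pos v hv
  have hfw := hf.pos w hw
  have hc0 : 0 < c := by positivity
  have hcw : c • w ≠ 0 := smul_ne_zero hc0.ne' hw
  have hfc : f v = f (c • w) := by
    rw [hf.homogeneous w c hc0, hc]
    field_simp
  by_cases hvc : v = c • w
  · have : c = 1 := by
      rw [hvc, norm_smul, Real.norm_of_nonneg hc0.le] at hn
      have := norm_pos_iff.2 hw
      field_simp at hn
      linarith
    rw [hvc, this, one_smul]
  · have := hf.fderiv_lt_of_eq hcw hfc hvc hv
    rw [h, map_smul, hf.homogeneous w c hc0, hf.fderiv_self hw, smul_eq_mul] at this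
    exact absurd this (lt_irrefl _)

end IsMinkowskiNorm

end

/-! ### The polar map and integration over the sphere -/

section

open MeasureTheory

variable {d : ℕ}

/-- The vector representing a linear form with respect to the Euclidean inner product. -/
def dualVec (d : ℕ) : (E d →L[ℝ] ℝ) →L[ℝ] E d :=
  ∑ i, (ContinuousLinearMap.apply ℝ ℝ (EuclideanSpace.single i (1 : ℝ) : E d)).smulRight
    (EuclideanSpace.single i (1 : ℝ))

theorem dualVec_apply (ξ : E d →L[ℝ] ℝ) (i : Fin (d + 1)) :
    dualVec d ξ i = ξ (EuclideanSpace.single i 1) := by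
  simp [dualVec, Finset.sum_apply, Pi.single_apply]

theorem euclidean_sum_single (w : E d) : w = ∑ i, w i • EuclideanSpace.single i (1 : ℝ) := by
  ext j
  simp [Finset.sum_apply, Pi.single_apply]

theorem inner_dualVec (ξ : E d →L[ℝ] ℝ) (w : E d) : inner ℝ (dualVec d ξ) w = ξ w := by
  conv_rhs => rw [euclidean_sum_single w, map_sum]
  simp [PiLp.inner_apply, dualVec_apply]

theorem dualVec_injective : Function.Injective (dualVec d) := fun ξ η h => by
  ext w
  rw [← inner_dualVec, ← inner_dualVec, h]

/-- The `1`-homogeneous map `v ↦ ‖v‖ df_v`, which sends the Euclidean unit ball to the unit ball of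
the norm dual to `f`. -/
def polarMap (f : E d → ℝ) (v : E d) : E d := ‖v‖ • dualVec d (fderiv ℝ f v)

/-- The Jacobian of `polarMap`. -/
def polarJacobian (f : E d → ℝ) (v : E d) : ℝ := (fderiv ℝ (polarMap f) v).det

theorem inner_polarMap (f : E d → ℝ) (v w : E d) :
    inner ℝ (polarMap f v) w = ‖v‖ * fderiv ℝ f v w := by
  rw [polarMap, real_inner_smul_left, inner_dualVec]

theorem hasFDerivAt_euclidean_norm {v : E d} (hv : v ≠ 0) :
    HasFDerivAt (fun v : E d => ‖v‖) (‖v‖⁻¹ • innerSL ℝ v) v := by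
  have h1 := (hasStrictFDerivAt_norm_sq v).hasFDerivAt.sqrt (by simpa using hv)
  have h2 : (fun v : E d => √(‖v‖ ^ 2)) = fun v => ‖v‖ := by
    funext v
    exact Real.sqrt_sq (norm_nonneg _)
  rw [h2] at h1
  refine h1.congr_fderiv ?_
  rw [Real.sqrt_sq (norm_nonneg _)]
  ext w
  have := norm_ne_zero_iff.2 hv
  simp
  field_simp

namespace IsMinkowskiNorm

variable {f : E d → ℝ} (hf : IsMinkowskiNorm f)
include hf

theorem hasFDerivAt_polarMap {v : E d} (hv : v ≠ 0) :
    HasFDerivAt (polarMap f) (‖v‖ • (dualVec d).comp (fderiv ℝ (fderiv ℝ f) v) +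
      (‖v‖⁻¹ • innerSL ℝ v).smulRight (dualVec d (fderiv ℝ f v))) v :=
  (hasFDerivAt_euclidean_norm hv).smul
    ((dualVec d).hasFDerivAt.comp v (hf.differentiableAt_fderiv hv).hasFDerivAt)

theorem contDiffOn_polarMap : ContDiffOn ℝ ∞ (polarMap f) {0}ᶜ := by
  have h1 : ContDiffOn ℝ ∞ (fderiv ℝ f) {0}ᶜ :=
    hf.smooth.fderiv_of_isOpen isOpen_compl_singleton (by simp)
  have h2 : ContDiffOn ℝ ∞ (fun v : E d => ‖v‖) {0}ᶜ := fun v hv =>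
    (contDiffAt_norm ℝ hv).contDiffWithinAt
  exact h2.smul ((dualVec d).contDiff.comp_contDiffOn h1)

theorem continuousOn_polarJacobian : ContinuousOn (polarJacobian f) {0}ᶜ :=
  ContinuousLinearMap.continuous_det.comp_continuousOn
    (hf.contDiffOn_polarMap.continuousOn_fderiv_of_isOpen isOpen_compl_singleton (by simp))

theorem polarMap_smul (v : E d) {c : ℝ} (hc : 0 < c) : polarMap f (c • v) = c • polarMap f v := by
  rw [polarMap, polarMap, hf.fderiv_smul v hc, norm_smul, Real.norm_of_nonneg hc.le, smul_smul]

theorem polarJacobian_smul (v : E d) {c : ℝ} (hc : 0 < c) :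
    polarJacobian f (c • v) = polarJacobian f v := by
  have h1 := fderiv_comp_smul (f := polarMap f) (x := v) c
  have h2 : (fun x => polarMap f (c • x)) = c • polarMap f := by
    funext x
    simp [hf.polarMap_smul x hc]
  rw [h2, fderiv_const_smul_field] at h1
  rw [polarJacobian, polarJacobian, ← smul_right_injective _ hc.ne' h1]

/-- At a unit vector the differential of the polar map is `D²f + s ⊗ df`. In this form the Jacobian
can be matched with `sum_mul_det_cons_succAbove` and `det_add_vecMulVec_pos`. -/
theorem polarJacobian_eq {s : E d} (hs : ‖s‖ = 1) : polarJacobian f s =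
    ((Matrix.of fun i k => fderiv ℝ (fderiv ℝ f) s (EuclideanSpace.single i 1)
      (EuclideanSpace.single k 1)) + Matrix.vecMulVec (fun i => s i)
        (fun k => fderiv ℝ f s (EuclideanSpace.single k 1))).det := by
  have hs0 : s ≠ 0 := by rintro rfl; simp at hs
  rw [polarJacobian, (hf.hasFDerivAt_polarMap hs0).fderiv, hs, ContinuousLinearMap.det,
    ← LinearMap.det_toMatrix (EuclideanSpace.basisFun (Fin (d + 1)) ℝ).toBasis,
    ← Matrix.det_transpose]
  congr 1
  ext i k
  rw [Matrix.transpose_apply, LinearMap.toMatrix_apply]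
  simp [dualVec_apply, Matrix.vecMulVec_apply, EuclideanSpace.inner_single_right]

theorem det_hess {s : E d} (hs : s ≠ 0) :
    (Matrix.of fun i k : Fin (d + 1) => fderiv ℝ (fderiv ℝ f) s (EuclideanSpace.single i 1)
      (EuclideanSpace.single k 1)).det = 0 := by
  rw [← Matrix.exists_mulVec_eq_zero_iff]
  refine ⟨fun i => s i, fun h => hs ?_, ?_⟩
  · ext i
    exact congrFun h i
  · ext i
    have := hf.hess_apply_self hs (EuclideanSpace.single i 1)
    conv_lhs at this => rw [euclidean_sum_single s, map_sum]
    simpa [Matrix.mulVec, dotProduct, mul_comm, ← euclidean_sum_single s] using this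

/-- The Jacobian is homogeneous of degree `0`, so unit vectors suffice. There
`det_add_vecMulVec_pos` applies with `H = D²f`, `a = df` and `c = f(v)`; its positivity hypothesis
is the strong convexity of `f²`. -/
theorem polarJacobian_pos {v : E d} (hv : v ≠ 0) : 0 < polarJacobian f v := by
  wlog hs : ‖v‖ = 1 generalizing v
  · have hn := norm_pos_iff.2 hv
    have := this (v := ‖v‖⁻¹ • v) (smul_ne_zero (inv_ne_zero hn.ne') hv)
      (by rw [norm_smul, norm_inv, norm_norm, inv_mul_cancel₀ hn.ne'])
    rwa [hf.polarJacobian_smul v (inv_pos.2 hn)] at this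
  have hsum : ∀ (ξ : E d →L[ℝ] ℝ) (w : Fin (d + 1) → ℝ),
      ∑ i, ξ (EuclideanSpace.single i 1) * w i = ξ (WithLp.toLp 2 w) := by
    intro ξ w
    conv_rhs => rw [euclidean_sum_single (WithLp.toLp 2 w), map_sum]
    simp [mul_comm]
  rw [hf.polarJacobian_eq hs]
  refine det_add_vecMulVec_pos _ _ _ (f v) (hf.pos v hv) ?_ ?_ ?_ ?_ ?_
  · ext i k
    exact hf.hess_symm hv _ _
  · ext i
    have := hsum (fderiv ℝ (fderiv ℝ f) v (EuclideanSpace.single i 1)) (fun i => v i)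
    simp only [Matrix.mulVec, dotProduct, Matrix.of_apply, Pi.zero_apply]
    rw [this]
    exact hf.hess_apply_self hv _
  · simp only [dotProduct]
    rw [hsum (fderiv ℝ f v) (fun i => v i)]
    exact hf.fderiv_self hv
  · have := EuclideanSpace.real_norm_sq_eq v
    rw [hs] at this
    simp only [dotProduct]
    rw [one_pow] at this
    exact (Finset.sum_congr rfl fun i _ => (sq _).symm).trans this.symm
  · intro w hw
    have hw' : WithLp.toLp 2 w ≠ (0 : E d) := fun h => hw (by
      ext i
      exact congrArg (fun u : E d => u i) h)
    have := hf.hess_pos hv hw'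
    have h2 : w ⬝ᵥ Matrix.mulVec (Matrix.of fun i k : Fin (d + 1) =>
        fderiv ℝ (fderiv ℝ f) v (EuclideanSpace.single i 1)
        (EuclideanSpace.single k 1)) w = fderiv ℝ (fderiv ℝ f) v (WithLp.toLp 2 w)
          (WithLp.toLp 2 w) := by
      rw [hf.hess_symm hv, ← hsum]
      simp only [dotProduct, Matrix.mulVec, Matrix.of_apply]
      refine Finset.sum_congr rfl fun i _ => ?_
      rw [hsum, mul_comm, hf.hess_symm hv]
    rw [h2]
    simp only [dotProduct]
    rw [hsum]
    exact this

/-- Pairing with `v` gives `‖v‖ f(v) = ‖w‖ df_w(v) ≤ ‖w‖ f(v)`. -/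
theorem norm_le_of_polarMap_eq {v w : E d} (hv : v ≠ 0) (hw : w ≠ 0)
    (h : polarMap f v = polarMap f w) : ‖v‖ ≤ ‖w‖ := by
  have h1 : ‖v‖ * f v = ‖w‖ * fderiv ℝ f w v := by
    rw [← hf.fderiv_self hv, ← inner_polarMap, h, inner_polarMap]
  have h2 := mul_le_mul_of_nonneg_left (hf.fderiv_le hw v) (norm_nonneg w)
  rw [← h1] at h2
  exact le_of_mul_le_mul_right h2 (hf.pos v hv)

theorem injOn_polarMap : Set.InjOn (polarMap f) {0}ᶜ := by
  intro v hv w hw h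
  have hn : ‖v‖ = ‖w‖ :=
    le_antisymm (hf.norm_le_of_polarMap_eq hv hw h) (hf.norm_le_of_polarMap_eq hw hv h.symm)
  refine hf.eq_of_fderiv_eq hv hw hn (dualVec_injective ?_)
  rw [polarMap, polarMap, ← hn] at h
  exact smul_right_injective _ (norm_ne_zero_iff.2 hv) h

/-- Every linear form that is positive somewhere is a multiple of a derivative of `f`. -/
theorem exists_polarMap_eq {ξ : E d} (hξ : ∃ u, 0 < inner ℝ ξ u) : ∃ v, v ≠ 0 ∧ polarMap f v = ξ := by
  set g : E d → ℝ := fun u => inner ℝ ξ u / f u with hg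
  have hgc : ContinuousOn g (Metric.sphere 0 1) := by
    refine ContinuousOn.div (by fun_prop) (hf.smooth.continuousOn.mono fun u hu => ?_) fun u hu => ?_
    · exact Metric.ne_of_mem_sphere hu one_ne_zero
    · exact (hf.pos u (Metric.ne_of_mem_sphere hu one_ne_zero)).ne'
  obtain ⟨u₀, hu₀, hmax⟩ := (isCompact_sphere (0 : E d) 1).exists_isMaxOn
    (NormedSpace.sphere_nonempty.2 zero_le_one) hgc
  have hu₀n : ‖u₀‖ = 1 := by simpa using hu₀
  have hu₀0 : u₀ ≠ 0 := Metric.ne_of_mem_sphere hu₀ one_ne_zero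
  have hgs : ∀ u (c : ℝ), 0 < c → g (c • u) = g u := by
    intro u c hc
    simp only [hg, inner_smul_right, hf.homogeneous u c hc]
    exact mul_div_mul_left _ _ hc.ne'
  have hall : ∀ u, u ≠ 0 → g u ≤ g u₀ := by
    intro u hu
    have hn := norm_pos_iff.2 hu
    rw [← hgs u ‖u‖⁻¹ (inv_pos.2 hn)]
    refine hmax ?_
    simp [norm_smul, inv_mul_cancel₀ hn.ne']
  have hfu := hf.pos u₀ hu₀0
  have hm : 0 < g u₀ := by
    obtain ⟨u, hu⟩ := hξ
    have hu0 : u ≠ 0 := by rintro rfl; simp at hu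
    exact lt_of_lt_of_le (div_pos hu (hf.pos u hu0)) (hall u hu0)
  -- Maximality of `ξ / f` at `u₀` makes `u₀` a local maximum of `ξ - g(u₀) f` too, so `ξ = g(u₀)
  -- df` at `u₀`. Since `‖u₀‖ = 1`, the preimage of `ξ` is `g(u₀) u₀`.
  have hloc : IsLocalMax (fun u => innerSL ℝ ξ u - g u₀ * f u) u₀ := by
    filter_upwards [isOpen_compl_singleton.mem_nhds hu₀0] with u hu
    have h1 := (div_le_iff₀ (hf.pos u hu)).1 (hall u hu)
    have h2 : g u₀ * f u₀ = inner ℝ ξ u₀ := div_mul_cancel₀ _ hfu.ne'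
    simp only [innerSL_apply_apply]
    linarith
  have hd := (innerSL ℝ ξ).hasFDerivAt.sub
    ((hf.differentiableAt hu₀0).hasFDerivAt.const_mul (g u₀))
  have h0 := hd.fderiv.symm.trans hloc.fderiv_eq_zero
  have hξw : ∀ w, inner ℝ ξ w = g u₀ * fderiv ℝ f u₀ w := by
    intro w
    have := congrArg (fun L : E d →L[ℝ] ℝ => L w) h0
    simp only [innerSL_apply_apply, _root_.smul_apply, _root_.sub_apply,
      _root_.zero_apply, smul_eq_mul] at this
    linarith
  refine ⟨g u₀ • u₀, smul_ne_zero hm.ne' hu₀0, ext_inner_right ℝ fun w => ?_⟩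
  rw [inner_polarMap, hξw, hf.fderiv_smul u₀ hm, norm_smul, hu₀n, Real.norm_of_nonneg hm.le, mul_one]

/-- Change of variables: injectivity excludes multiplicities and positivity of the Jacobian removes
the absolute value. This is how integrals over directions become volumes of sets of covectors. -/
theorem lintegral_polarJacobian {A : Set (E d)} (hA : MeasurableSet A) (hA0 : A ⊆ {0}ᶜ) :
    ∫⁻ v in A, ENNReal.ofReal (polarJacobian f v) = volume (polarMap f '' A) := by
  rw [← lintegral_abs_det_fderiv_eq_addHaar_image volume hA
    (fun v hv => ((hf.hasFDerivAt_polarMap (hA0 hv)).differentiableAt.hasFDerivAt).hasFDerivWithinAt)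
    (hf.injOn_polarMap.mono hA0)]
  refine setLIntegral_congr_fun hA fun v hv => ?_
  change _ = ENNReal.ofReal |polarJacobian f v|
  rw [abs_of_pos (hf.polarJacobian_pos (hA0 hv))]

end IsMinkowskiNorm

/-- The area of a subset of the sphere is `n` times the volume of the cone over it. -/
theorem map_coe_toSphere : (volume : Measure (E d)).toSphere.map (Subtype.val) =
    ((d + 1 : ℕ) : ENNReal) • (volume.restrict (Metric.ball (0 : E d) 1 \ {0})).map
      (fun v => ‖v‖⁻¹ • v) := by
  have hmeas : Measurable (fun v : E d => ‖v‖⁻¹ • v) := by fun_prop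
  ext A hA
  rw [Measure.map_apply measurable_subtype_coe hA, Measure.toSphere_apply' _
    (measurable_subtype_coe hA), Measure.smul_apply, Measure.map_apply hmeas hA,
    Measure.restrict_apply (hmeas hA), smul_eq_mul]
  congr 2
  · simp
  · ext v
    simp only [Set.mem_smul, Set.mem_image, Set.mem_preimage, Set.mem_inter_iff, Set.mem_sdiff,
      Metric.mem_ball, dist_zero_right, Set.mem_singleton_iff]
    constructor
    · rintro ⟨c, hc, _, ⟨s, hs, rfl⟩, rfl⟩
      have hsn : ‖(s : E d)‖ = 1 := by simp
      have hs0 : (s : E d) ≠ 0 := by rw [← norm_ne_zero_iff, hsn]; exact one_ne_zero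
      have hcn : ‖c • (s : E d)‖ = c := by
        rw [norm_smul, hsn, Real.norm_of_nonneg hc.1.le, mul_one]
      refine ⟨?_, by rw [hcn]; exact hc.2, smul_ne_zero hc.1.ne' hs0⟩
      rw [hcn, smul_smul, inv_mul_cancel₀ hc.1.ne', one_smul]
      exact hs
    · rintro ⟨h1, h2, h3⟩
      have hn := norm_pos_iff.2 h3
      refine ⟨‖v‖, ⟨hn, h2⟩, ‖v‖⁻¹ • v, ⟨⟨‖v‖⁻¹ • v, ?_⟩, h1, rfl⟩, ?_⟩
      · simp [norm_smul, inv_mul_cancel₀ hn.ne']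
      · rw [smul_smul, mul_inv_cancel₀ hn.ne', one_smul]

theorem aestronglyMeasurable_map_normalize {k : E d → ℝ} (hk : ContinuousOn k (Metric.sphere 0 1)) :
    AEStronglyMeasurable k ((volume.restrict (Metric.ball (0 : E d) 1 \ {0})).map
      (fun v => ‖v‖⁻¹ • v)) := by
  have hmeas : Measurable (fun v : E d => ‖v‖⁻¹ • v) := by fun_prop
  have hB : MeasurableSet (Metric.ball (0 : E d) 1 \ {0}) :=
    measurableSet_ball.diff (measurableSet_singleton _)
  rw [← Measure.restrict_eq_self_of_ae_mem (s := Metric.sphere (0 : E d) 1)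
    (μ := (volume.restrict (Metric.ball (0 : E d) 1 \ {0})).map (fun v => ‖v‖⁻¹ • v))]
  · exact hk.aestronglyMeasurable Metric.isClosed_sphere.measurableSet
  · refine (ae_map_iff hmeas.aemeasurable (p := fun v => v ∈ Metric.sphere (0 : E d) 1)
      Metric.isClosed_sphere.measurableSet).2 ?_
    filter_upwards [ae_restrict_mem hB] with v hv
    have hn : ‖v‖ ≠ 0 := norm_ne_zero_iff.2 hv.2
    simp [norm_smul, inv_mul_cancel₀ hn]

/-- Integration over the sphere in terms of integration over the ball. -/
theorem integral_toSphere {k : E d → ℝ} (hk : ContinuousOn k (Metric.sphere 0 1)) :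
    ∫ s : Metric.sphere (0 : E d) 1, k s ∂(volume : Measure (E d)).toSphere =
      ((d + 1 : ℕ) : ℝ) * ∫ v in Metric.ball (0 : E d) 1 \ {0}, k (‖v‖⁻¹ • v) := by
  have hmeas : Measurable (fun v : E d => ‖v‖⁻¹ • v) := by fun_prop
  rw [← (MeasurableEmbedding.subtype_coe Metric.isClosed_sphere.measurableSet).integral_map,
    map_coe_toSphere, integral_smul_measure,
    integral_map hmeas.aemeasurable (aestronglyMeasurable_map_normalize hk),
    ENNReal.toReal_natCast, smul_eq_mul]

theorem integrableOn_normalize {k : E d → ℝ} (hk : ContinuousOn k (Metric.sphere 0 1)) :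
    IntegrableOn (fun v => k (‖v‖⁻¹ • v)) (Metric.ball (0 : E d) 1 \ {0}) := by
  have hB : MeasurableSet (Metric.ball (0 : E d) 1 \ {0}) :=
    measurableSet_ball.diff (measurableSet_singleton _)
  obtain ⟨B, hBd⟩ := (isCompact_sphere (0 : E d) 1).exists_bound_of_continuousOn hk
  have : IsFiniteMeasure (volume.restrict (Metric.ball (0 : E d) 1 \ {0})) :=
    ⟨by rw [Measure.restrict_apply_univ]
        exact (measure_mono Set.sdiff_subset).trans_lt measure_ball_lt_top⟩
  refine Integrable.of_bound (C := B) ?_ ?_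
  · exact (aestronglyMeasurable_map_normalize hk).comp_measurable (by fun_prop)
  · filter_upwards [ae_restrict_mem hB] with v hv
    have hn : ‖v‖ ≠ 0 := norm_ne_zero_iff.2 hv.2
    exact hBd _ (by simp [norm_smul, inv_mul_cancel₀ hn])

end

/-! ### Estimates for Minkowski norms -/

section

open MeasureTheory
variable {d : ℕ}

/-- The ball of radius `r` of linear forms, for the norm dual to `N`. -/
def dualBall (N : E d → ℝ) (r : ℝ) : Set (E d) := {ξ | ∀ v, inner ℝ ξ v ≤ r * N v}

theorem isClosed_dualBall (N : E d → ℝ) (r : ℝ) : IsClosed (dualBall N r) := by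
  simp only [dualBall, Set.ofPred_forall]
  exact isClosed_iInter fun v => isClosed_le (by fun_prop) continuous_const

open scoped Pointwise in
theorem dualBall_eq_smul (N : E d → ℝ) {r : ℝ} (hr : 0 < r) :
    dualBall N r = r • dualBall N 1 := by
  ext ξ
  rw [Set.mem_smul_set_iff_inv_smul_mem₀ hr.ne']
  simp only [dualBall, Set.mem_ofPred_eq, real_inner_smul_left, one_mul]
  refine forall_congr' fun v => ?_
  rw [inv_mul_le_iff₀ hr]

theorem volume_dualBall (N : E d → ℝ) {r : ℝ} (hr : 0 < r) :
    volume (dualBall N r) = ENNReal.ofReal (r ^ (d + 1)) * volume (dualBall N 1) := by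
  rw [dualBall_eq_smul N hr, Measure.addHaar_smul, abs_of_pos (by positivity)]
  simp

theorem integrable_toSphere {k : E d → ℝ} (hk : ContinuousOn k (Metric.sphere 0 1)) :
    Integrable (fun s : Metric.sphere (0 : E d) 1 => k s) (volume : Measure (E d)).toSphere :=
  (continuousOn_iff_continuous_domRestrict.1 hk).integrable_of_hasCompactSupport
    (HasCompactSupport.of_compactSpace _)

namespace IsMinkowskiNorm

variable {f : E d → ℝ} (hf : IsMinkowskiNorm f)
include hf

theorem continuousOn_sphere : ContinuousOn f (Metric.sphere 0 1) :=
  hf.smooth.continuousOn.mono fun _ hu => Metric.ne_of_mem_sphere hu one_ne_zero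

theorem continuousOn_sphere_polarJacobian : ContinuousOn (polarJacobian f) (Metric.sphere 0 1) :=
  hf.continuousOn_polarJacobian.mono fun _ hu => Metric.ne_of_mem_sphere hu one_ne_zero

theorem continuousOn_sphere_ratio (p : E d →L[ℝ] ℝ) :
    ContinuousOn (fun s => (p s / f s) ^ 2) (Metric.sphere 0 1) :=
  (p.continuous.continuousOn.div hf.continuousOn_sphere
    fun s hs => (hf.pos s (Metric.ne_of_mem_sphere hs one_ne_zero)).ne').pow 2

theorem integral_polarJacobian_pos :
    0 < ∫ s : Metric.sphere (0 : E d) 1, polarJacobian f s ∂(volume : Measure (E d)).toSphere := by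
  have hc := continuousOn_iff_continuous_domRestrict.1 hf.continuousOn_sphere_polarJacobian
  have hs : ∀ s : Metric.sphere (0 : E d) 1, 0 < polarJacobian f s := fun s =>
    hf.polarJacobian_pos (Metric.ne_of_mem_sphere s.2 one_ne_zero)
  rw [integral_pos_iff_support_of_nonneg (fun s => (hs s).le)
    (integrable_toSphere hf.continuousOn_sphere_polarJacobian)]
  have : Function.support (fun s : Metric.sphere (0 : E d) 1 => polarJacobian f s) = Set.univ :=
    Set.eq_univ_of_forall fun s => (hs s).ne'
  rw [this]
  exact Measure.measure_univ_pos.2 (Measure.toSphere_ne_zero _)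

theorem integral_toSphere_mul_polarJacobian {k : E d → ℝ} (hk : ContinuousOn k (Metric.sphere 0 1))
    (hkh : ∀ v (c : ℝ), 0 < c → k (c • v) = k v) :
    ∫ s : Metric.sphere (0 : E d) 1, k s * polarJacobian f s ∂(volume : Measure (E d)).toSphere =
      ((d + 1 : ℕ) : ℝ) * ∫ v in Metric.ball (0 : E d) 1 \ {0}, k v * polarJacobian f v := by
  rw [integral_toSphere (k := fun s => k s * polarJacobian f s)
    (hk.mul hf.continuousOn_sphere_polarJacobian)]
  congr 1
  refine setIntegral_congr_fun (measurableSet_ball.diff (measurableSet_singleton _)) fun v hv => ?_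
  have hn := inv_pos.2 (norm_pos_iff.2 hv.2)
  simp only [hkh v _ hn, hf.polarJacobian_smul v hn]

theorem integrableOn_mul_polarJacobian {k : E d → ℝ} (hk : ContinuousOn k (Metric.sphere 0 1))
    (hkh : ∀ v (c : ℝ), 0 < c → k (c • v) = k v) :
    IntegrableOn (fun v => k v * polarJacobian f v) (Metric.ball (0 : E d) 1 \ {0}) := by
  refine (integrableOn_normalize (k := fun s => k s * polarJacobian f s)
    (hk.mul hf.continuousOn_sphere_polarJacobian)).congr_fun (fun v hv => ?_)
    (measurableSet_ball.diff (measurableSet_singleton _))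
  have hn := inv_pos.2 (norm_pos_iff.2 hv.2)
  simp only [hkh v _ hn, hf.polarJacobian_smul v hn]

theorem ratio_smul (p : E d →L[ℝ] ℝ) (v : E d) (c : ℝ) (hc : 0 < c) :
    (p (c • v) / f (c • v)) ^ 2 = (p v / f v) ^ 2 := by
  rw [hf.homogeneous v c hc, map_smul, smul_eq_mul, mul_div_mul_left _ _ hc.ne']

variable {N : E d → ℝ} {C : ℝ} (hC : 1 < C) (hlow : ∀ v, N v ≤ C * f v) (hup : ∀ v, f v ≤ C * N v)
  (hneg : ∀ v, N (-v) = N v) (hpos : ∀ v, v ≠ 0 → 0 < N v)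
  {p : E d →L[ℝ] ℝ} {q : ℝ} (hq : 0 < q) (hpq : ∀ v, p v ≤ q * N v)

-- Here `N` stands for the norm of `g₀` and `q` for the dual norm of `p`. Pointwise `|p(s)| ≤ q N(s)
-- ≤ C q f(s)`, the absolute value being allowed because `N` is even although `f` need not be.
include hlow hneg hpq hq in
theorem integral_ratio_le :
    ∫ s : Metric.sphere (0 : E d) 1, (p s / f s) ^ 2 * polarJacobian f s
        ∂(volume : Measure (E d)).toSphere ≤
      (C * q) ^ 2 * ∫ s : Metric.sphere (0 : E d) 1, polarJacobian f s
        ∂(volume : Measure (E d)).toSphere := by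
  rw [← integral_const_mul]
  refine integral_mono (integrable_toSphere (k := fun s => (p s / f s) ^ 2 * polarJacobian f s)
    ((hf.continuousOn_sphere_ratio p).mul hf.continuousOn_sphere_polarJacobian))
    ((integrable_toSphere hf.continuousOn_sphere_polarJacobian).const_mul _) fun s => ?_
  have hs : (s : E d) ≠ 0 := Metric.ne_of_mem_sphere s.2 one_ne_zero
  have hfs := hf.pos s hs
  refine mul_le_mul_of_nonneg_right ?_ (hf.polarJacobian_pos hs).le
  rw [sq_le_sq, abs_div, abs_of_pos hfs]
  refine le_trans ?_ (le_abs_self _)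
  rw [div_le_iff₀ hfs]
  have h1 : |p s| ≤ q * N s := abs_le'.2 ⟨hpq s, by rw [← map_neg, ← hneg]; exact hpq _⟩
  refine h1.trans ?_
  calc q * N s ≤ q * (C * f s) := mul_le_mul_of_nonneg_left (hlow s) hq.le
    _ = C * q * f s := by ring

/-- If `‖v‖ df_v` is close to a positive multiple of `p`, then `p v` is bounded below. -/
theorem le_ratio_of_polarMap (hC : 1 < C) (hlow : ∀ v, N v ≤ C * f v) (hup : ∀ v, f v ≤ C * N v)
    (hneg : ∀ v, N (-v) = N v) {r : ℝ} (hr : 0 < r) (hq : 0 < q)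
    (hattain : ∀ c, c < q → ∃ u, 0 < N u ∧ c * N u < p u) {v : E d} (hv : v ≠ 0)
    (h : polarMap f v - (r / q) • dualVec d p ∈ dualBall N (r / (4 * C ^ 2))) :
    q / (2 * C) ≤ p v / f v := by
  have hC0 : 0 < C := by linarith
  have hinner : ∀ w, inner ℝ (polarMap f v - (r / q) • dualVec d p) w =
      ‖v‖ * fderiv ℝ f v w - r / q * p w := by
    intro w
    rw [inner_sub_left, inner_polarMap, real_inner_smul_left, inner_dualVec]
  have hup' : ∀ w, ‖v‖ * fderiv ℝ f v w - r / q * p w ≤ r / (4 * C ^ 2) * N w := fun w => by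
    rw [← hinner]; exact h w
  have hlo' : ∀ w, -(r / (4 * C ^ 2) * N w) ≤ ‖v‖ * fderiv ℝ f v w - r / q * p w := fun w => by
    have := hup' (-w)
    rw [hneg, map_neg, map_neg] at this
    linarith
  -- The covector `‖v‖ df_v` has `N`-dual norm at most `C ‖v‖`, and at least `r - r / (4 C²)`
  -- because it is that close to `(r / q) p`, of dual norm `r`. Otherwise a vector nearly attaining
  -- the norm of `p` gives a contradiction.
  have hvn : r * (1 - 1 / (4 * C ^ 2)) ≤ ‖v‖ * C := by
    by_contra hcon
    push Not at hcon
    obtain ⟨u, hu, hu'⟩ := hattain (q / r * (‖v‖ * C + r / (4 * C ^ 2))) (by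
      rw [div_mul_eq_mul_div, div_lt_iff₀ hr]
      refine mul_lt_mul_of_pos_left ?_ hq
      have : r / (4 * C ^ 2) = r * (1 / (4 * C ^ 2)) := by ring
      linarith)
    have h1 := hlo' u
    have h2 : ‖v‖ * fderiv ℝ f v u ≤ ‖v‖ * (C * N u) :=
      mul_le_mul_of_nonneg_left ((hf.fderiv_le hv u).trans (hup u)) (norm_nonneg v)
    have h3 : (‖v‖ * C + r / (4 * C ^ 2)) * N u < r / q * p u := by
      have h4 := mul_lt_mul_of_pos_left hu' (div_pos hr hq)
      have h5 : r / q * (q / r * (‖v‖ * C + r / (4 * C ^ 2)) * N u) =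
          (‖v‖ * C + r / (4 * C ^ 2)) * N u := by
        field_simp
      linarith
    have h6 : (‖v‖ * C + r / (4 * C ^ 2)) * N u =
      ‖v‖ * (C * N u) + r / (4 * C ^ 2) * N u := by ring
    linarith
  have hfv := hf.pos v hv
  have h1 := hup' v
  rw [hf.fderiv_self hv] at h1
  have h2 : r / (4 * C ^ 2) * N v ≤ r / (4 * C ^ 2) * (C * f v) :=
    mul_le_mul_of_nonneg_left (hlow v) (by positivity)
  -- Evaluate the closeness at `v` itself, where Euler's identity gives `‖v‖ df_v(v) = ‖v‖ f(v)`.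
  -- With `‖v‖ ≥ 3r / (4C)` from `hvn`, the bracket is at least `r / (2C)`.
  have h3 : (‖v‖ - r / (4 * C)) * f v ≤ r / q * p v := by
    have : r / (4 * C ^ 2) * (C * f v) = r / (4 * C) * f v := by
      field_simp
    linarith
  have hC2 : 1 / (4 * C ^ 2) ≤ 1 / 4 := by
    apply one_div_le_one_div_of_le (by norm_num)
    nlinarith
  have h4 : r / (2 * C) ≤ ‖v‖ - r / (4 * C) := by
    have h5 : r * (3 / 4) ≤ ‖v‖ * C :=
      (mul_le_mul_of_nonneg_left (by linarith) hr.le).trans hvn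
    have h6 : r * (3 / 4) / C ≤ ‖v‖ := (div_le_iff₀ hC0).2 h5
    have h7 : r / (2 * C) + r / (4 * C) = r * (3 / 4) / C := by
      field_simp
      ring
    linarith
  have h5 : r / (2 * C) * f v ≤ r / q * p v :=
    (mul_le_mul_of_nonneg_right h4 hfv.le).trans h3
  rw [le_div_iff₀ hfv]
  have h6 := mul_le_mul_of_nonneg_left h5 (div_pos hq hr).le
  have h7 : q / r * (r / (2 * C) * f v) = q / (2 * C) * f v := by field_simp
  have h8 : q / r * (r / q * p v) = p v := by field_simp
  linarith

-- The integrals are volumes under the polar map. The image of the whole ball `B` lies in `dualBall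
-- N C`. The image of its part `A` contains `D`, a translate of `dualBall N (r / (4 C²))`, and on
-- `A` the ratio `p / f` is at least `q / (2C)`. The two radii have quotient `1 / (16 C⁴)`, which
-- enters to the power of the dimension.
include hC hlow hup hneg hpos hpq hq in
theorem le_integral_ratio (hattain : ∀ c, c < q → ∃ u, 0 < N u ∧ c * N u < p u) :
    (q / (2 * C)) ^ 2 * (1 / (16 * C ^ 4)) ^ (d + 1) *
        ∫ s : Metric.sphere (0 : E d) 1, polarJacobian f s ∂(volume : Measure (E d)).toSphere ≤
      ∫ s : Metric.sphere (0 : E d) 1, (p s / f s) ^ 2 * polarJacobian f s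
        ∂(volume : Measure (E d)).toSphere := by
  have hC0 : 0 < C := by linarith
  set B : Set (E d) := Metric.ball (0 : E d) 1 \ {0} with hB
  have hBm : MeasurableSet B := measurableSet_ball.diff (measurableSet_singleton _)
  have hB0 : B ⊆ {0}ᶜ := fun v hv => hv.2
  -- With this `r`, a covector `ξ` in `D` satisfies `ξ(v) < 2 r N(v) ≤ f(v) / 2` for `v ≠ 0`, so its
  -- preimage under the polar map has norm below `1 / 2` and lies in `B`.
  set r : ℝ := 1 / (4 * C) with hr
  have hr0 : 0 < r := by positivity
  set D : Set (E d) := (fun ξ => ξ - (r / q) • dualVec d p) ⁻¹' dualBall N (r / (4 * C ^ 2)) with hD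
  have hDm : IsClosed D := (isClosed_dualBall N _).preimage (by fun_prop)
  set A : Set (E d) := B ∩ polarMap f ⁻¹' D with hA
  have hAm : MeasurableSet A := by
    have hopen : IsOpen B := Metric.isOpen_ball.sdiff isClosed_singleton
    have hc : ContinuousOn (polarMap f) B := hf.contDiffOn_polarMap.continuousOn.mono hB0
    obtain ⟨U, hU, hU'⟩ := continuousOn_iff_isClosed.1 hc D hDm
    rw [hA, Set.inter_comm, hU']
    exact hU.measurableSet.inter hBm
  have hDA : D ⊆ polarMap f '' A := by
    intro ξ hξ
    have hξ' : ∀ w, inner ℝ ξ w - r / q * p w ≤ r / (4 * C ^ 2) * N w := fun w => by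
      have := hξ w
      rwa [inner_sub_left, real_inner_smul_left, inner_dualVec] at this
    have hC2 : 1 / (4 * C ^ 2) < 1 := by
      rw [div_lt_one (by positivity)]
      nlinarith
    have hpos' : ∃ u, 0 < inner ℝ ξ u := by
      obtain ⟨u, hu, hu'⟩ := hattain (q * (1 / (4 * C ^ 2))) (by nlinarith)
      refine ⟨u, ?_⟩
      have := hξ' (-u)
      rw [hneg, inner_neg_right, map_neg] at this
      have h2 := mul_lt_mul_of_pos_left hu' (div_pos hr0 hq)
      have h3 : r / q * (q * (1 / (4 * C ^ 2)) * N u) = r / (4 * C ^ 2) * N u := by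
        field_simp
      linarith
    obtain ⟨v, hv, hvξ⟩ := hf.exists_polarMap_eq hpos'
    refine ⟨v, ⟨⟨?_, hv⟩, by rw [Set.mem_preimage, hvξ]; exact hξ⟩, hvξ⟩
    have h1 := hξ' v
    rw [← hvξ, inner_polarMap, hf.fderiv_self hv] at h1
    have hfv := hf.pos v hv
    have h2 : r / q * p v ≤ r * N v := by
      have := mul_le_mul_of_nonneg_left (hpq v) (div_pos hr0 hq).le
      have h3 : r / q * (q * N v) = r * N v := by field_simp
      linarith
    have h4 : ‖v‖ * f v < 2 * r * N v := by
      have h5 : r / (4 * C ^ 2) * N v < r * N v := by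
        refine mul_lt_mul_of_pos_right ?_ (hpos v hv)
        have : r / (4 * C ^ 2) = r * (1 / (4 * C ^ 2)) := by ring
        rw [this]
        nlinarith
      linarith
    have h6 : 2 * r * N v ≤ 2 * r * (C * f v) := mul_le_mul_of_nonneg_left (hlow v) (by positivity)
    have h7 : 2 * r * (C * f v) = 1 / 2 * f v := by
      rw [hr]
      field_simp
      norm_num
    have h8 : ‖v‖ < 1 / 2 := lt_of_mul_lt_mul_right (by linarith) hfv.le
    simp only [Metric.mem_ball, dist_zero_right]
    linarith
  have hBC : polarMap f '' B ⊆ dualBall N C := by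
    rintro _ ⟨v, hv, rfl⟩ w
    rw [inner_polarMap]
    have hv1 : ‖v‖ ≤ 1 := by
      have := hv.1
      rw [Metric.mem_ball, dist_zero_right] at this
      exact this.le
    have h1 := (hf.fderiv_le (hB0 hv) w).trans (hup w)
    have hN : 0 ≤ N w := by
      by_contra hcon
      push Not at hcon
      have := hup w
      have := hf.nonneg w
      nlinarith
    calc ‖v‖ * fderiv ℝ f v w ≤ ‖v‖ * (C * N w) := mul_le_mul_of_nonneg_left h1 (norm_nonneg v)
      _ ≤ 1 * (C * N w) := mul_le_mul_of_nonneg_right hv1 (by positivity)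
      _ = C * N w := one_mul _
  have hJB : IntegrableOn (polarJacobian f) B := by
    have := hf.integrableOn_mul_polarJacobian (k := fun _ => 1) continuousOn_const
      (fun _ _ _ => rfl)
    simpa using this
  have setInt : ∀ S, S ⊆ B → MeasurableSet S →
      ENNReal.ofReal (∫ v in S, polarJacobian f v) = volume (polarMap f '' S) := by
    intro S hS hSm
    rw [← hf.lintegral_polarJacobian hSm (hS.trans hB0),
      ofReal_integral_eq_lintegral_ofReal (hJB.mono_set hS)]
    filter_upwards [ae_restrict_mem hSm] with v hv
    exact (hf.polarJacobian_pos (hB0 (hS hv))).le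
  have hIB : 0 ≤ ∫ v in B, polarJacobian f v :=
    setIntegral_nonneg hBm fun v hv => (hf.polarJacobian_pos (hB0 hv)).le
  have hIA : 0 ≤ ∫ v in A, polarJacobian f v :=
    setIntegral_nonneg hAm fun v hv => (hf.polarJacobian_pos (hB0 hv.1)).le
  have hvol : (1 / (16 * C ^ 4)) ^ (d + 1) * ∫ v in B, polarJacobian f v ≤
      ∫ v in A, polarJacobian f v := by
    rw [← ENNReal.ofReal_le_ofReal_iff hIA, ENNReal.ofReal_mul (by positivity),
      setInt B subset_rfl hBm, setInt A Set.inter_subset_left hAm]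
    calc ENNReal.ofReal ((1 / (16 * C ^ 4)) ^ (d + 1)) * volume (polarMap f '' B)
        ≤ ENNReal.ofReal ((1 / (16 * C ^ 4)) ^ (d + 1)) * volume (dualBall N C) := by
          gcongr
      _ = volume (dualBall N (r / (4 * C ^ 2))) := by
          have e : 1 / (16 * C ^ 4) * C = r / (4 * C ^ 2) := by
            rw [hr]
            field_simp
            norm_num
          rw [volume_dualBall N hC0, volume_dualBall N (r := r / (4 * C ^ 2)) (by positivity), ← mul_assoc,
            ← ENNReal.ofReal_mul (by positivity), ← mul_pow, e]
      _ = volume D := by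
          simp only [hD, sub_eq_add_neg]
          exact (measure_preimage_add_right volume _ _).symm
      _ ≤ volume (polarMap f '' A) := measure_mono hDA
  have hJ := hf.integral_toSphere_mul_polarJacobian (k := fun _ => 1) continuousOn_const
    (fun _ _ _ => rfl)
  simp only [one_mul] at hJ
  rw [hf.integral_toSphere_mul_polarJacobian (hf.continuousOn_sphere_ratio p) (hf.ratio_smul p), hJ]
  have hIR := hf.integrableOn_mul_polarJacobian (hf.continuousOn_sphere_ratio p) (hf.ratio_smul p)
  have hfin : (q / (2 * C)) ^ 2 * ∫ v in A, polarJacobian f v ≤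
      ∫ v in B, (p v / f v) ^ 2 * polarJacobian f v := by
    rw [← integral_const_mul]
    calc ∫ v in A, (q / (2 * C)) ^ 2 * polarJacobian f v
        ≤ ∫ v in A, (p v / f v) ^ 2 * polarJacobian f v := by
          refine setIntegral_mono_on ((hJB.mono_set Set.inter_subset_left).const_mul _)
            (hIR.mono_set Set.inter_subset_left) hAm fun v hv => ?_
          have hv0 := hB0 hv.1
          refine mul_le_mul_of_nonneg_right ?_ (hf.polarJacobian_pos hv0).le
          refine pow_le_pow_left₀ (by positivity) ?_ 2
          exact hf.le_ratio_of_polarMap hC hlow hup hneg hr0 hq hattain hv0 hv.2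
      _ ≤ ∫ v in B, (p v / f v) ^ 2 * polarJacobian f v := by
          refine setIntegral_mono_set hIR ?_ (Set.inter_subset_left.eventuallyLE)
          filter_upwards [ae_restrict_mem hBm] with v hv
          exact mul_nonneg (sq_nonneg _) (hf.polarJacobian_pos (hB0 hv)).le
  have hd : (0 : ℝ) ≤ ((d + 1 : ℕ) : ℝ) := Nat.cast_nonneg _
  have h1 := mul_le_mul_of_nonneg_left hvol (sq_nonneg (q / (2 * C)))
  have h2 := mul_le_mul_of_nonneg_left (h1.trans hfin) hd
  calc _ = ((d + 1 : ℕ) : ℝ) * ((q / (2 * C)) ^ 2 * ((1 / (16 * C ^ 4)) ^ (d + 1) *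
        ∫ v in B, polarJacobian f v)) := by ring
    _ ≤ _ := h2

end IsMinkowskiNorm

end

/-! ### Charts of the tangent bundle -/

section

variable {d : ℕ} {M : Type*} [TopologicalSpace M] [ChartedSpace (E d) M]
  [IsManifold (𝓡 (d + 1)) ∞ M]

theorem extChartAt_tangent_apply (q q' : TangentBundle (𝓡 (d + 1)) M) :
    extChartAt (𝓡 (d + 1)).tangent q q' =
      (extChartAt (𝓡 (d + 1)) q.1 q'.1,
        tangentCoordChange (𝓡 (d + 1)) q'.1 q.1 q'.1 q'.2) := rfl

theorem extChartAt_tangent_fiber (x : M) (v w : E d) :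
    extChartAt (𝓡 (d + 1)).tangent (⟨x, v⟩ : TangentBundle (𝓡 (d + 1)) M) ⟨x, w⟩ =
      (extChartAt (𝓡 (d + 1)) x x, w) := by
  rw [extChartAt_tangent_apply]
  exact Prod.ext rfl (tangentCoordChange_self (mem_extChartAt_source x))

theorem extChartAt_tangent_symm_fiber (x : M) (v w : E d) :
    (extChartAt (𝓡 (d + 1)).tangent (⟨x, v⟩ : TangentBundle (𝓡 (d + 1)) M)).symm
      (extChartAt (𝓡 (d + 1)) x x, w) = ⟨x, w⟩ := by
  rw [← extChartAt_tangent_fiber x v w]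
  refine (extChartAt (𝓡 (d + 1)).tangent (⟨x, v⟩ : TangentBundle (𝓡 (d + 1)) M)).left_inv ?_
  rw [extChartAt_source, TangentBundle.mem_chart_source_iff]
  exact mem_chart_source _ x

theorem mem_extChartAt_tangent_target (q : TangentBundle (𝓡 (d + 1)) M) (z : E d × E d) :
    z ∈ (extChartAt (𝓡 (d + 1)).tangent q).target ↔
      z.1 ∈ (extChartAt (𝓡 (d + 1)) q.1).target := by
  simp only [mfld_simps]
  exact TangentBundle.mem_chart_target_iff (I := 𝓡 (d + 1)) z q

theorem isOpen_extChartAt_tangent_target (q : TangentBundle (𝓡 (d + 1)) M) :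
    IsOpen (extChartAt (𝓡 (d + 1)).tangent q).target := by
  have h : (extChartAt (𝓡 (d + 1)).tangent q).target =
      Prod.fst ⁻¹' (extChartAt (𝓡 (d + 1)) q.1).target := by
    ext z
    exact mem_extChartAt_tangent_target q z
  rw [h]
  exact (isOpen_extChartAt_target q.1).preimage continuous_fst

theorem mfderiv_extChartAt_symm {x : M} {y : E d} (hy : y ∈ (extChartAt (𝓡 (d + 1)) x).target) :
    mfderiv 𝓘(ℝ, E d) (𝓡 (d + 1)) (extChartAt (𝓡 (d + 1)) x).symm y =
      tangentCoordChange (𝓡 (d + 1)) x ((extChartAt (𝓡 (d + 1)) x).symm y)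
        ((extChartAt (𝓡 (d + 1)) x).symm y) := by
  have h1 : MDifferentiableAt 𝓘(ℝ, E d) (𝓡 (d + 1)) (extChartAt (𝓡 (d + 1)) x).symm y :=
    ((contMDiffOn_extChartAt_symm (n := 1) x).contMDiffAt
      ((isOpen_extChartAt_target x).mem_nhds hy)).mdifferentiableAt one_ne_zero
  rw [h1.mfderiv, tangentCoordChange_def, (extChartAt (𝓡 (d + 1)) x).right_inv hy]
  simp [writtenInExtChartAt]
  rfl

theorem mdifferentiableAt_proj (q : TangentBundle (𝓡 (d + 1)) M) :
    MDifferentiableAt (𝓡 (d + 1)).tangent (𝓡 (d + 1))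
      (fun q' : TangentBundle (𝓡 (d + 1)) M => q'.1) q :=
  (Bundle.contMDiff_proj (n := 1) (TangentSpace (𝓡 (d + 1)) : M → Type _)).mdifferentiableAt
    one_ne_zero

theorem mdifferentiableAt_extChartAt_tangent_symm {q : TangentBundle (𝓡 (d + 1)) M} {z : E d × E d}
    (hz : z ∈ (extChartAt (𝓡 (d + 1)).tangent q).target) :
    MDifferentiableAt 𝓘(ℝ, E d × E d) (𝓡 (d + 1)).tangent
      (extChartAt (𝓡 (d + 1)).tangent q).symm z :=
  ((contMDiffOn_extChartAt_symm (n := 1) q).contMDiffAt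
      ((isOpen_extChartAt_tangent_target q).mem_nhds hz)).mdifferentiableAt one_ne_zero

theorem dproj_comp_mfderiv_symm {q : TangentBundle (𝓡 (d + 1)) M} {z : E d × E d}
    (hz : z ∈ (extChartAt (𝓡 (d + 1)).tangent q).target) :
    (dproj ((extChartAt (𝓡 (d + 1)).tangent q).symm z)).comp
      (mfderiv 𝓘(ℝ, E d × E d) (𝓡 (d + 1)).tangent
        (extChartAt (𝓡 (d + 1)).tangent q).symm z) =
    (tangentCoordChange (𝓡 (d + 1)) q.1 ((extChartAt (𝓡 (d + 1)) q.1).symm z.1)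
      ((extChartAt (𝓡 (d + 1)) q.1).symm z.1)).comp (ContinuousLinearMap.fst ℝ (E d) (E d)) := by
  have hz1 := (mem_extChartAt_tangent_target q z).1 hz
  have h1 : MDifferentiableAt 𝓘(ℝ, E d) (𝓡 (d + 1)) (extChartAt (𝓡 (d + 1)) q.1).symm z.1 :=
    ((contMDiffOn_extChartAt_symm (n := 1) q.1).contMDiffAt
      ((isOpen_extChartAt_target q.1).mem_nhds hz1)).mdifferentiableAt one_ne_zero
  have h2 : MDifferentiableAt 𝓘(ℝ, E d × E d) 𝓘(ℝ, E d) (Prod.fst : E d × E d → E d) z :=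
    differentiableAt_fst.mdifferentiableAt
  have e1 := mfderiv_comp z (mdifferentiableAt_proj _) (mdifferentiableAt_extChartAt_tangent_symm hz)
  have e2 := mfderiv_comp z h1 h2
  rw [mfderiv_extChartAt_symm hz1, mfderiv_eq_fderiv, fderiv_fst] at e2
  exact e1.symm.trans e2

/-- Vectors in the tangent space at `q` are coordinates in the chart at `q` itself, in which the
projection is the first factor. -/
theorem dproj_apply (q : TangentBundle (𝓡 (d + 1)) M) (Z : TangentSpace (𝓡 (d + 1)).tangent q) :
    dproj q Z = (show E d × E d from Z).1 := by
  have he : writtenInExtChartAt (𝓡 (d + 1)).tangent (𝓡 (d + 1)) q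
      (fun q' : TangentBundle (𝓡 (d + 1)) M => q'.1) =ᶠ[𝓝 (extChartAt (𝓡 (d + 1)).tangent q q)]
        (Prod.fst : E d × E d → E d) := by
    filter_upwards [(isOpen_extChartAt_tangent_target q).mem_nhds (mem_extChartAt_target q)]
      with z hz
    exact (extChartAt (𝓡 (d + 1)) q.1).right_inv ((mem_extChartAt_tangent_target q z).1 hz)
  rw [dproj, (mdifferentiableAt_proj q).mfderiv, ModelWithCorners.range_eq_univ, fderivWithin_univ,
    he.fderiv_eq, fderiv_fst]
  rfl

theorem contMDiff_fiber (x : M) : ContMDiff 𝓘(ℝ, E d) (𝓡 (d + 1)).tangent ∞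
    (fun u : E d => (⟨x, u⟩ : TangentBundle (𝓡 (d + 1)) M)) := by
  have h : (fun u : E d => (⟨x, u⟩ : TangentBundle (𝓡 (d + 1)) M)) =
      (extChartAt (𝓡 (d + 1)).tangent (⟨x, 0⟩ : TangentBundle (𝓡 (d + 1)) M)).symm ∘
        fun u => (extChartAt (𝓡 (d + 1)) x x, u) := by
    funext u
    exact (extChartAt_tangent_symm_fiber x 0 u).symm
  rw [h]
  have h1 : ContMDiff 𝓘(ℝ, E d) 𝓘(ℝ, E d × E d) ∞ (fun u : E d => (extChartAt (𝓡 (d + 1)) x x, u)) :=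
    (contDiff_prodMk_right _).contMDiff
  intro u
  refine ContMDiffAt.comp u ?_ (h1 u)
  refine (contMDiffOn_extChartAt_symm (⟨x, 0⟩ : TangentBundle (𝓡 (d + 1)) M)).contMDiffAt
    ((isOpen_extChartAt_tangent_target _).mem_nhds ?_)
  rw [mem_extChartAt_tangent_target]
  exact mem_extChartAt_target x

theorem verticalLift_apply (x : M) (v u : E d) :
    verticalLift x v u = (show TangentSpace (𝓡 (d + 1)).tangent
      (⟨x, v⟩ : TangentBundle (𝓡 (d + 1)) M) from ((0, u) : E d × E d)) := by
  have hd : MDifferentiableAt 𝓘(ℝ, E d) (𝓡 (d + 1)).tangent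
    (fun u : E d => (⟨x, u⟩ : TangentBundle (𝓡 (d + 1)) M)) v :=
    (contMDiff_fiber x).mdifferentiableAt (by simp)
  have he : writtenInExtChartAt 𝓘(ℝ, E d) (𝓡 (d + 1)).tangent v
      (fun u : E d => (⟨x, u⟩ : TangentBundle (𝓡 (d + 1)) M)) =
        fun u => (extChartAt (𝓡 (d + 1)) x x, u) := by
    funext u
    exact extChartAt_tangent_fiber x v u
  rw [verticalLift, hd.mfderiv, he, ModelWithCorners.range_eq_univ, fderivWithin_univ]
  have := (hasFDerivAt_prodMk_right (𝕜 := ℝ) (extChartAt (𝓡 (d + 1)) x x) v).fderiv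
  exact congrArg (fun L : E d →L[ℝ] E d × E d => L u) this

end

/-! ### The Hilbert form and its Reeb field -/

section

variable {d : ℕ} {M : Type*} [TopologicalSpace M] [ChartedSpace (E d) M]
  [IsManifold (𝓡 (d + 1)) ∞ M]

theorem tangentCoordChange_symm_ne_zero {x : M} {y : E d}
    (hy : y ∈ (extChartAt (𝓡 (d + 1)) x).target) {u : E d} (hu : u ≠ 0) :
    tangentCoordChange (𝓡 (d + 1)) x ((extChartAt (𝓡 (d + 1)) x).symm y)
        ((extChartAt (𝓡 (d + 1)) x).symm y) u ≠ 0 := by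
  intro h
  set y' := (extChartAt (𝓡 (d + 1)) x).symm y with hy'
  have hs : y' ∈ (extChartAt (𝓡 (d + 1)) x).source := (extChartAt (𝓡 (d + 1)) x).map_target hy
  have h1 := tangentCoordChange_comp (I := 𝓡 (d + 1)) (w := x) (x := y') (y := x) (z := y') (v := u)
    ⟨⟨hs, mem_extChartAt_source y'⟩, hs⟩
  rw [tangentCoordChange_self hs, h, map_zero] at h1
  exact hu h1.symm

theorem hilbertForm_apply (F : TangentBundle (𝓡 (d + 1)) M → ℝ) (x : M) (v : E d)
    (Z : TangentSpace (𝓡 (d + 1)).tangent (⟨x, v⟩ : TangentBundle (𝓡 (d + 1)) M)) :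
    hilbertForm F ⟨x, v⟩ Z = fderiv ℝ (fun u : E d => F ⟨x, u⟩) v (show E d × E d from Z).1 := by
  rw [← dproj_apply]
  rfl

namespace IsFinslerMetric

variable {F : TangentBundle (𝓡 (d + 1)) M → ℝ} (hF : IsFinslerMetric F)
include hF

/-- The expression of `F` in a chart of the tangent bundle is smooth off the zero section. -/
theorem contDiffOn_chart (q : TangentBundle (𝓡 (d + 1)) M) :
    ContDiffOn ℝ ∞ (fun z : E d × E d => F ((extChartAt (𝓡 (d + 1)).tangent q).symm z))
      ((extChartAt (𝓡 (d + 1)).tangent q).target ∩ {z | z.2 ≠ 0}) := by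
  rw [← contMDiffOn_iff_contDiffOn]
  refine hF.smooth.comp ((contMDiffOn_extChartAt_symm q).mono Set.inter_subset_left) ?_
  rintro z ⟨hz, hz2⟩
  exact tangentCoordChange_symm_ne_zero ((mem_extChartAt_tangent_target q z).1 hz) hz2

theorem isMinkowskiNorm (x : M) : IsMinkowskiNorm (fun u : E d => F ⟨x, u⟩) where
  smooth := by
    rw [← contMDiffOn_iff_contDiffOn]
    exact hF.smooth.comp (contMDiff_fiber x).contMDiffOn fun u hu => hu
  homogeneous v c hc := hF.homogeneous x v c hc
  pos v hv := lt_of_le_of_ne (hF.nonneg _) fun h => hv ((hF.eq_zero_iff x v).1 h.symm)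
  stronglyConvex v w hv hw := hF.stronglyConvex x v w hv hw

/-- The expression of the Hilbert form in a chart. -/
theorem hilbertForm_comp_mfderiv_symm {q : TangentBundle (𝓡 (d + 1)) M} {z : E d × E d}
    (hz : z ∈ (extChartAt (𝓡 (d + 1)).tangent q).target) (hz2 : z.2 ≠ 0) :
    (hilbertForm F ((extChartAt (𝓡 (d + 1)).tangent q).symm z)).comp
      (mfderiv 𝓘(ℝ, E d × E d) (𝓡 (d + 1)).tangent
        (extChartAt (𝓡 (d + 1)).tangent q).symm z) =
    ((fderiv ℝ (fun z : E d × E d => F ((extChartAt (𝓡 (d + 1)).tangent q).symm z)) z).comp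
      (ContinuousLinearMap.inr ℝ (E d) (E d))).comp (ContinuousLinearMap.fst ℝ (E d) (E d)) := by
  set y := (extChartAt (𝓡 (d + 1)) q.1).symm z.1 with hy
  set T := tangentCoordChange (𝓡 (d + 1)) q.1 y y with hT
  have hT0 : T z.2 ≠ 0 :=
    tangentCoordChange_symm_ne_zero ((mem_extChartAt_tangent_target q z).1 hz) hz2
  have h1 : HasFDerivAt (fun u : E d => F ⟨y, T u⟩)
      ((fderiv ℝ (fun u : E d => F ⟨y, u⟩) (T z.2)).comp T) z.2 :=
    ((hF.isMinkowskiNorm y).differentiableAt hT0).hasFDerivAt.comp z.2 T.hasFDerivAt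
  have h2 : DifferentiableAt ℝ
      (fun z : E d × E d => F ((extChartAt (𝓡 (d + 1)).tangent q).symm z)) z :=
    ((hF.contDiffOn_chart q).contDiffAt (((isOpen_extChartAt_tangent_target q).inter
      (isOpen_ne.preimage continuous_snd)).mem_nhds ⟨hz, hz2⟩)).differentiableAt (by simp)
  have h3 := HasFDerivAt.comp (g := fun z : E d × E d =>
    F ((extChartAt (𝓡 (d + 1)).tangent q).symm z)) z.2 h2.hasFDerivAt
    (hasFDerivAt_prodMk_right (𝕜 := ℝ) z.1 z.2)
  have h4 := h3.unique h1
  rw [h4]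
  exact congrArg (fun L : E d × E d →L[ℝ] E d => (fderiv ℝ (fun u : E d => F ⟨y, u⟩) (T z.2)).comp L)
    (dproj_comp_mfderiv_symm hz)

/-- The exterior derivative of the Hilbert form in a chart. -/
theorem exists_extDeriv_hilbertForm (x : M) {v : E d} (hv : v ≠ 0) :
    ∃ b : E d × E d →L[ℝ] (E d →L[ℝ] ℝ),
      (∀ u, b (0, u) = fderiv ℝ (fderiv ℝ (fun u : E d => F ⟨x, u⟩)) v u) ∧
      ∀ Z W : E d × E d,
        extDerivOneForm (hilbertForm F) (⟨x, v⟩ : TangentBundle (𝓡 (d + 1)) M) ![Z, W] =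
          b Z W.1 - b W Z.1 := by
  set q : TangentBundle (𝓡 (d + 1)) M := ⟨x, v⟩ with hq
  set Fc : E d × E d → ℝ := fun z => F ((extChartAt (𝓡 (d + 1)).tangent q).symm z) with hFc
  set U : Set (E d × E d) := (extChartAt (𝓡 (d + 1)).tangent q).target ∩ {z | z.2 ≠ 0} with hU
  have hUo : IsOpen U := (isOpen_extChartAt_tangent_target q).inter
    (isOpen_ne.preimage continuous_snd)
  set z₀ := extChartAt (𝓡 (d + 1)).tangent q q with hz₀
  have hz₀' : z₀ = (extChartAt (𝓡 (d + 1)) x x, v) := extChartAt_tangent_fiber x v v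
  have hz₀U : z₀ ∈ U := ⟨mem_extChartAt_target q, by rw [hz₀']; exact hv⟩
  -- In the chart the Hilbert form is `G dx` with `G = ∂_v F`, so its exterior derivative is `dG ∧
  -- dx` and `b` is the derivative of `G`; in vertical directions this is the Hessian of `F(x, ·)`.
  set G : E d × E d → (E d →L[ℝ] ℝ) := fun z =>
    (fderiv ℝ Fc z).comp (ContinuousLinearMap.inr ℝ (E d) (E d)) with hG
  have hGd : DifferentiableAt ℝ G z₀ := by
    have h1 : ContDiffOn ℝ ∞ (fderiv ℝ Fc) U :=
      (hF.contDiffOn_chart q).fderiv_of_isOpen hUo (by simp)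
    have h2 := (h1.contDiffAt (hUo.mem_nhds hz₀U)).differentiableAt (by simp)
    exact h2.clm_comp (differentiableAt_const _)
  refine ⟨fderiv ℝ G z₀, ?_, ?_⟩
  · intro u
    have h1 : (fun w : E d => G (extChartAt (𝓡 (d + 1)) x x, w)) =ᶠ[𝓝 v]
        fderiv ℝ (fun u : E d => F ⟨x, u⟩) := by
      filter_upwards [isOpen_ne.mem_nhds hv] with w hw
      have hw' : ((extChartAt (𝓡 (d + 1)) x x, w) : E d × E d) ∈ U := by
        refine ⟨?_, hw⟩
        rw [mem_extChartAt_tangent_target]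
        exact mem_extChartAt_target x
      have h2 := ((hF.contDiffOn_chart q).contDiffAt (hUo.mem_nhds hw')).differentiableAt (by simp)
      have h3 := HasFDerivAt.comp (g := Fc) w h2.hasFDerivAt
        (hasFDerivAt_prodMk_right (𝕜 := ℝ) (extChartAt (𝓡 (d + 1)) x x) w)
      have h4 : (Fc ∘ fun w => (extChartAt (𝓡 (d + 1)) x x, w)) = fun u : E d => F ⟨x, u⟩ := by
        funext u
        exact congrArg F (extChartAt_tangent_symm_fiber x v u)
      rw [h4] at h3
      exact h3.fderiv.symm
    have h5 : HasFDerivAt (fun w : E d => G (extChartAt (𝓡 (d + 1)) x x, w))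
        ((fderiv ℝ G z₀).comp (ContinuousLinearMap.inr ℝ (E d) (E d))) v := by
      rw [hz₀'] at hGd ⊢
      exact HasFDerivAt.comp (g := G) v hGd.hasFDerivAt
        (hasFDerivAt_prodMk_right (𝕜 := ℝ) (extChartAt (𝓡 (d + 1)) x x) v)
    rw [← h1.fderiv_eq, h5.fderiv]
    rfl
  · intro Z W
    set Λ : (E d × E d →L[ℝ] ℝ) ≃ₗᵢ[ℝ] (E d × E d) [⋀^Fin 1]→L[ℝ] ℝ :=
      ContinuousAlternatingMap.ofSubsingletonLIE (0 : Fin 1)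
    have he : (fun z : E d × E d => ContinuousAlternatingMap.ofSubsingleton ℝ (E d × E d) ℝ
        (0 : Fin 1) ((hilbertForm F ((extChartAt (𝓡 (d + 1)).tangent q).symm z)).comp
        (mfderiv 𝓘(ℝ, E d × E d) (𝓡 (d + 1)).tangent
          (extChartAt (𝓡 (d + 1)).tangent q).symm z))) =ᶠ[𝓝 z₀]
        fun z => Λ ((G z).comp (ContinuousLinearMap.fst ℝ (E d) (E d))) := by
      filter_upwards [hUo.mem_nhds hz₀U] with z hz
      exact congrArg (ContinuousAlternatingMap.ofSubsingleton ℝ (E d × E d) ℝ (0 : Fin 1))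
        (hF.hilbertForm_comp_mfderiv_symm hz.1 hz.2)
    have h1 : DifferentiableAt ℝ (fun z => Λ ((G z).comp (ContinuousLinearMap.fst ℝ (E d) (E d)))) z₀ :=
      Λ.differentiableAt.comp z₀ (hGd.clm_comp (differentiableAt_const _))
    have h2 : ∀ w : E d, fderiv ℝ (fun z => G z w) z₀ = (fderiv ℝ G z₀).flip w := by
      intro w
      refine ContinuousLinearMap.ext fun Y => ?_
      have := (hGd.hasFDerivAt.clm_apply (hasFDerivAt_const w z₀)).fderiv
      rw [this]
      simp
    have key : extDeriv (fun z : E d × E d => Λ ((G z).comp (ContinuousLinearMap.fst ℝ (E d) (E d)))) z₀ ![Z, W] =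
          fderiv ℝ G z₀ Z W.1 - fderiv ℝ G z₀ W Z.1 := by
      rw [extDeriv_apply h1, Fin.sum_univ_two]
      have e0 : ∀ z, (Λ ((G z).comp (ContinuousLinearMap.fst ℝ (E d) (E d))))
            (Fin.removeNth 0 ![Z, W]) = G z W.1 := fun z => rfl
      have e1 : ∀ z, (Λ ((G z).comp (ContinuousLinearMap.fst ℝ (E d) (E d))))
            (Fin.removeNth 1 ![Z, W]) = G z Z.1 := fun z => rfl
      simp only [e0, e1, h2]
      simp [sub_eq_add_neg]
    rw [← key, ← he.extDeriv_eq]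
    rfl

/-- Since `reebField` is a choice, its defining equations hold only once they are solvable. Take `ξ
= v / f(v)`; then `i_Z dA = 0` for `Z = (ξ, η)` becomes `D²f(η, ·) = ψ`. -/
theorem exists_isReebVector (x : M) {v : E d} (hv : v ≠ 0) :
    ∃ Z, IsReebVector F (⟨x, v⟩ : TangentBundle (𝓡 (d + 1)) M) Z := by
  have hf := hF.isMinkowskiNorm x
  set f : E d → ℝ := fun u => F ⟨x, u⟩ with hfdef
  obtain ⟨b, hb, hext⟩ := hF.exists_extDeriv_hilbertForm x hv
  have hfv := hf.pos v hv
  set ξ : E d := (f v)⁻¹ • v with hξ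
  set ψ : E d →L[ℝ] ℝ := (b.comp (ContinuousLinearMap.inl ℝ (E d) (E d))).flip ξ - b (ξ, 0) with hψ
  have hψv : ψ v = 0 := by
    have h1 : ((ξ, 0) : E d × E d) = (f v)⁻¹ • ((v, 0) : E d × E d) := by simp [hξ]
    simp only [hψ, _root_.sub_apply, ContinuousLinearMap.flip_apply,
      ContinuousLinearMap.comp_apply, ContinuousLinearMap.inl_apply]
    rw [h1, map_smul, map_smul]
    simp
  obtain ⟨η, hη⟩ : ∃ η, fderiv ℝ (fderiv ℝ f) v η = ψ := by
    -- The Hessian is degenerate along `v`, but `f D²f + df ⊗ df` is positive definite and hence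
    -- onto. Evaluating its equation for `η` at `v`, where `ψ(v) = 0`, gives `df(η) = 0`, and the
    -- extra term disappears.
    set L : E d →ₗ[ℝ] E d := ((dualVec d).comp (f v • fderiv ℝ (fderiv ℝ f) v +
      (fderiv ℝ f v).smulRight (fderiv ℝ f v))).toLinearMap with hL
    have hLapp : ∀ u w, inner ℝ (L u) w = f v * fderiv ℝ (fderiv ℝ f) v u w +
        fderiv ℝ f v u * fderiv ℝ f v w := by
      intro u w
      simp [hL, inner_dualVec, inner_add_left, inner_smul_left]
    have hinj : Function.Injective L := by
      rw [injective_iff_map_eq_zero]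
      intro u hu
      by_contra hne
      have h1 := hf.hess_pos hv hne
      have h2 := hLapp u u
      rw [hu, inner_zero_left] at h2
      nlinarith
    obtain ⟨η, hη⟩ := LinearMap.injective_iff_surjective.1 hinj (f v • dualVec d ψ)
    have h1 : ∀ w, f v * fderiv ℝ (fderiv ℝ f) v η w + fderiv ℝ f v η * fderiv ℝ f v w =
        f v * ψ w := by
      intro w
      rw [← hLapp, hη, real_inner_smul_left, inner_dualVec]
    have h2 : fderiv ℝ f v η = 0 := by
      have := h1 v
      rw [hf.hess_apply_self hv, hf.fderiv_self hv, hψv] at this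
      simpa [hfv.ne'] using this
    refine ⟨η, ?_⟩
    ext w
    have := h1 w
    rw [h2, zero_mul, add_zero] at this
    exact mul_left_cancel₀ hfv.ne' this
  refine ⟨((ξ, η) : E d × E d), ?_, ?_⟩
  · refine (hilbertForm_apply F x v _).trans ?_
    change fderiv ℝ f v ξ = 1
    rw [hξ, map_smul, hf.fderiv_self hv, smul_eq_mul, inv_mul_cancel₀ hfv.ne']
  · intro W
    obtain ⟨ξ', η'⟩ : E d × E d := W
    refine (hext (ξ, η) (ξ', η')).trans ?_
    have e1 : b (ξ, η) = b (ξ, 0) + ψ := by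
      rw [← hη, ← hb η, ← map_add]
      simp
    have e2 : b (ξ', η') ξ = b (ξ', 0) ξ := by
      have : b (ξ', η') = b (ξ', 0) + fderiv ℝ (fderiv ℝ f) v η' := by
        rw [← hb η', ← map_add]
        simp
      rw [this, _root_.add_apply, hξ, map_smul (fderiv ℝ (fderiv ℝ f) v η'),
        hf.hess_apply_self hv]
      simp
    rw [e1, e2, hψ]
    simp

/-- Pairing `Z` with vertical vectors in `dA` puts its base component in the kernel of the Hessian,
the line of `v`; `A(Z) = 1` fixes the factor. The vertical component is not needed for the symbol.
-/
theorem fst_of_isReebVector (x : M) {v : E d} (hv : v ≠ 0)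
    {Z : TangentSpace (𝓡 (d + 1)).tangent (⟨x, v⟩ : TangentBundle (𝓡 (d + 1)) M)}
    (hZ : IsReebVector F (⟨x, v⟩ : TangentBundle (𝓡 (d + 1)) M) Z) :
    (show E d × E d from Z).1 = (F ⟨x, v⟩)⁻¹ • v := by
  have hf := hF.isMinkowskiNorm x
  obtain ⟨b, hb, hext⟩ := hF.exists_extDeriv_hilbertForm x hv
  obtain ⟨ξ, η⟩ : E d × E d := Z
  have hA := (hilbertForm_apply F x v _).symm.trans hZ.1
  have h1 : fderiv ℝ (fderiv ℝ (fun u : E d => F ⟨x, u⟩)) v ξ = 0 := by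
    ext u
    have h2 := (hext (ξ, η) (0, u)).symm.trans (hZ.2 ((0, u) : E d × E d))
    rw [hb, map_zero, zero_sub, neg_eq_zero, hf.hess_symm hv] at h2
    exact h2
  obtain ⟨c, rfl⟩ := (hf.hess_eq_zero_iff hv).1 h1
  change fderiv ℝ (fun u : E d => F ⟨x, u⟩) v (c • v) = 1 at hA
  rw [map_smul, hf.fderiv_self hv, smul_eq_mul] at hA
  change c • v = _
  rw [eq_inv_of_mul_eq_one_left hA]

theorem dproj_reebField {q : TangentBundle (𝓡 (d + 1)) M} (hq : q.2 ≠ 0) :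
    dproj q (reebField F q) = (F q)⁻¹ • q.2 := by
  rw [dproj_apply]
  exact hF.fst_of_isReebVector q.1 hq (Classical.epsilon_spec (hF.exists_isReebVector q.1 hq))

end IsFinslerMetric

end

/-! ### Lie derivatives along the Reeb field -/

section

variable {d : ℕ} {M : Type*} [TopologicalSpace M] [ChartedSpace (E d) M]
  [IsManifold (𝓡 (d + 1)) ∞ M]

/-- Near `q` this function is the fibre component of the tangent map of `φ`, which is of class `C¹`.
-/
theorem mdifferentiableAt_mfderiv_apply {φ : M → ℝ} {q : TangentBundle (𝓡 (d + 1)) M}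
    (hφ : ContMDiffAt (𝓡 (d + 1)) 𝓘(ℝ, ℝ) ∞ φ q.1) :
    MDifferentiableAt (𝓡 (d + 1)).tangent 𝓘(ℝ, ℝ)
      (fun q' : TangentBundle (𝓡 (d + 1)) M =>
        (mfderiv (𝓡 (d + 1)) 𝓘(ℝ, ℝ) φ q'.1 q'.2 : ℝ)) q := by
  have h2 : ContMDiffAt (𝓡 (d + 1)) 𝓘(ℝ, ℝ) 2 φ q.1 := hφ.of_le (WithTop.coe_le_coe.2 le_top)
  have : IsManifold (𝓡 (d + 1)) 2 M :=
    IsManifold.of_le (n := ∞) (WithTop.coe_le_coe.2 le_top)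
  obtain ⟨u, hu, hφu⟩ := (contMDiffAt_iff_contMDiffOn_nhds (n := 2) (by decide)).1 h2
  obtain ⟨U, hUu, hUo, hxU⟩ := mem_nhds_iff.1 hu
  have h3 := (hφu.mono hUu).contMDiffOn_tangentMapWithin (m := 1) (by norm_num) hUo.uniqueMDiffOn
  have hpre : IsOpen (Bundle.TotalSpace.proj ⁻¹' U : Set (TangentBundle (𝓡 (d + 1)) M)) :=
    hUo.preimage (FiberBundle.continuous_proj (E d) (TangentSpace (𝓡 (d + 1)) : M → Type _))
  have h4 := (h3.contMDiffAt (hpre.mem_nhds hxU)).mdifferentiableAt one_ne_zero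
  have h5 : MDifferentiableAt 𝓘(ℝ, ℝ).tangent 𝓘(ℝ, ℝ)
      (fun p : TangentBundle 𝓘(ℝ, ℝ) ℝ => (p.2 : ℝ))
      (tangentMapWithin (𝓡 (d + 1)) 𝓘(ℝ, ℝ) φ U q) :=
    (contMDiff_snd_tangentBundle_modelSpace ℝ 𝓘(ℝ, ℝ) (n := 1)).mdifferentiableAt one_ne_zero
  refine (h5.comp q h4).congr_of_eventuallyEq ?_
  filter_upwards [hpre.mem_nhds hxU] with q' hq'
  exact congrArg (fun L : E d →L[ℝ] ℝ => L q'.2)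
    (mfderivWithin_of_isOpen (I := 𝓡 (d + 1)) (I' := 𝓘(ℝ, ℝ)) (f := φ) hUo hq').symm

namespace IsFinslerMetric

variable {F : TangentBundle (𝓡 (d + 1)) M → ℝ} (hF : IsFinslerMetric F)
include hF

theorem pos {q : TangentBundle (𝓡 (d + 1)) M} (hq : q.2 ≠ 0) : 0 < F q :=
  (hF.isMinkowskiNorm q.1).pos q.2 hq

theorem eventually_ne_zero {q : TangentBundle (𝓡 (d + 1)) M} (hq : q.2 ≠ 0) :
    ∀ᶠ q' in 𝓝 q, q'.2 ≠ 0 := by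
  filter_upwards [hF.continuous.continuousAt.eventually_ne (hF.pos hq).ne'] with q' hq' h
  exact hq' ((hF.eq_zero_iff q'.1 q'.2).2 h)

theorem mdifferentiableAt {q : TangentBundle (𝓡 (d + 1)) M} (hq : q.2 ≠ 0) :
    MDifferentiableAt (𝓡 (d + 1)).tangent 𝓘(ℝ, ℝ) F q :=
  (hF.smooth.contMDiffAt (hF.eventually_ne_zero hq)).mdifferentiableAt (by simp)

theorem lieReeb_comp_proj {f : M → ℝ} {q : TangentBundle (𝓡 (d + 1)) M} (hq : q.2 ≠ 0)
    {f' : TangentSpace (𝓡 (d + 1)) q.1 →L[ℝ] ℝ}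
    (hf : HasMFDerivAt (𝓡 (d + 1)) 𝓘(ℝ, ℝ) f q.1 f') :
    lieReeb F (fun q' : TangentBundle (𝓡 (d + 1)) M => f q'.1) q = f' q.2 / F q := by
  have h1 : HasMFDerivAt (𝓡 (d + 1)).tangent 𝓘(ℝ, ℝ)
      (fun q' : TangentBundle (𝓡 (d + 1)) M => f q'.1) q (f'.comp (dproj q)) :=
    HasMFDerivAt.comp q hf (mdifferentiableAt_proj q).hasMFDerivAt
  rw [lieReeb, h1.mfderiv]
  change f' (dproj q (reebField F q)) = _
  rw [hF.dproj_reebField hq, map_smul, smul_eq_mul, inv_mul_eq_div]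

/-- The second Lie derivative of the square of a function that vanishes at the base point. -/
theorem lieReeb_lieReeb_sq {φ : M → ℝ} {x : M} (hφ : ContMDiffAt (𝓡 (d + 1)) 𝓘(ℝ, ℝ) ∞ φ x)
    (hφx : φ x = 0) {p : TangentSpace (𝓡 (d + 1)) x →L[ℝ] ℝ}
    (hp : mfderiv (𝓡 (d + 1)) 𝓘(ℝ, ℝ) φ x = p) {v : E d} (hv : v ≠ 0) :
    lieReeb F (lieReeb F (fun q : TangentBundle (𝓡 (d + 1)) M => φ q.1 ^ 2)) ⟨x, v⟩ =
      2 * (p v / F ⟨x, v⟩) ^ 2 := by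
  subst hp
  set q : TangentBundle (𝓡 (d + 1)) M := ⟨x, v⟩ with hqdef
  have hq : q.2 ≠ 0 := hv
  set k : TangentBundle (𝓡 (d + 1)) M → ℝ := fun q' =>
    (mfderiv (𝓡 (d + 1)) 𝓘(ℝ, ℝ) φ q'.1 q'.2 : ℝ) with hk
  have hk1 : MDifferentiableAt (𝓡 (d + 1)).tangent 𝓘(ℝ, ℝ) k q :=
    mdifferentiableAt_mfderiv_apply hφ
  have hk2 := hk1.div (hF.mdifferentiableAt hq) (hF.pos hq).ne'
  have hφ1 : ∀ᶠ y in 𝓝 x, MDifferentiableAt (𝓡 (d + 1)) 𝓘(ℝ, ℝ) φ y := by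
    have : IsManifold (𝓡 (d + 1)) 1 M := IsManifold.of_le (n := ∞) (WithTop.coe_le_coe.2 le_top)
    have h1 : ContMDiffAt (𝓡 (d + 1)) 𝓘(ℝ, ℝ) 1 φ x := hφ.of_le (WithTop.coe_le_coe.2 le_top)
    obtain ⟨u, hu, hφu⟩ := (contMDiffAt_iff_contMDiffOn_nhds (n := 1) (by decide)).1 h1
    obtain ⟨U, hUu, hUo, hxU⟩ := mem_nhds_iff.1 hu
    filter_upwards [hUo.mem_nhds hxU] with y hy
    exact ((hφu.mono hUu).contMDiffAt (hUo.mem_nhds hy)).mdifferentiableAt one_ne_zero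
  have hproj : Filter.Tendsto (fun q' : TangentBundle (𝓡 (d + 1)) M => q'.1) (𝓝 q) (𝓝 x) :=
    (FiberBundle.continuous_proj (E d) (TangentSpace (𝓡 (d + 1)) : M → Type _)).continuousAt
  -- The explicit formula `L_X(φ²) = 2 φ · dφ(v) / F` holds on a neighbourhood of `q`, so it can be
  -- differentiated although the Reeb field was chosen pointwise.
  have he : lieReeb F (fun q : TangentBundle (𝓡 (d + 1)) M => φ q.1 ^ 2) =ᶠ[𝓝 q]
      (fun q' : TangentBundle (𝓡 (d + 1)) M => φ q'.1) * (2 • (k / F)) := by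
    filter_upwards [hproj.eventually hφ1, hF.eventually_ne_zero hq] with q' h1 h2
    have h3 := h1.hasMFDerivAt.mul h1.hasMFDerivAt
    have h4 := hF.lieReeb_comp_proj (f := φ * φ) h2 h3
    have h5 : (fun q : TangentBundle (𝓡 (d + 1)) M => φ q.1 ^ 2) =
        fun q => (φ * φ) q.1 := by
      funext q
      simp [sq]
    rw [h5, h4]
    change (φ q'.1 * k q' + φ q'.1 * k q') / F q' = φ q'.1 * (2 • (k q' / F q'))
    rw [two_nsmul]
    ring
  have hφ' := (hφ1.self_of_nhds).hasMFDerivAt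
  have h6 : HasMFDerivAt (𝓡 (d + 1)).tangent 𝓘(ℝ, ℝ)
      (fun q' : TangentBundle (𝓡 (d + 1)) M => φ q'.1) q
        ((mfderiv (𝓡 (d + 1)) 𝓘(ℝ, ℝ) φ x).comp (dproj q)) :=
    HasMFDerivAt.comp q hφ' (mdifferentiableAt_proj q).hasMFDerivAt
  have hk3 : MDifferentiableAt (𝓡 (d + 1)).tangent 𝓘(ℝ, ℝ) (2 • (k / F)) q := by
    rw [two_nsmul]
    exact hk2.add hk2
  have h7 := h6.mul hk3.hasMFDerivAt
  refine (congrArg (fun L : E d × E d →L[ℝ] ℝ => L (reebField F q))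
    (he.mfderiv_eq.trans h7.mfderiv)).trans ?_
  have hR : dproj q (reebField F q) = (F q)⁻¹ • v := hF.dproj_reebField hq
  let P : E d →L[ℝ] ℝ := mfderiv (𝓡 (d + 1)) 𝓘(ℝ, ℝ) φ x
  let D : E d × E d →L[ℝ] ℝ := mfderiv (𝓡 (d + 1)).tangent 𝓘(ℝ, ℝ) (2 • (k / F)) q
  change φ x * D (reebField F q) + (2 • (P v / F q)) * P (dproj q (reebField F q)) =
    2 * (P v / F q) ^ 2
  have hPR : P (dproj q (reebField F q)) = (F q)⁻¹ * P v := by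
    rw [hR]
    exact P.map_smul _ _
  -- Only the term in which `φ` is differentiated survives; the one that sees the vertical part of
  -- the Reeb vector has the factor `φ x = 0`.
  rw [hφx, hPR, two_nsmul]
  ring

end IsFinslerMetric

end

/-! ### The angle form and the symbol -/

section

open MeasureTheory

theorem wedge_smul_compLinearMap_smul {V V' : Type*} [AddCommGroup V] [Module ℝ V]
    [AddCommGroup V'] [Module ℝ V'] {k l : ℕ} (a : V [⋀^Fin k]→ₗ[ℝ] ℝ)
    (b : V' [⋀^Fin l]→ₗ[ℝ] ℝ) (L : V →ₗ[ℝ] V') (s t : ℝ) (W : Fin (k + l) → V) :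
    wedge (s • a) ((t • b).compLinearMap L) W = s * t * wedge a (b.compLinearMap L) W := by
  simp only [wedge, AlternatingMap.smul_apply, AlternatingMap.compLinearMap_apply, smul_eq_mul,
    Finset.mul_sum]
  refine Finset.sum_congr rfl fun σ _ => ?_
  ring

variable {d : ℕ}

/-- The standard volume form of `ℝⁿ`. -/
def stdVolumeForm (d : ℕ) : E d [⋀^Fin (d + 1)]→ₗ[ℝ] ℝ :=
  Matrix.detRowAlternating.compLinearMap (WithLp.linearEquiv 2 ℝ (Fin (d + 1) → ℝ)).toLinearMap

theorem stdVolumeForm_single :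
    stdVolumeForm d (fun i => EuclideanSpace.single i (1 : ℝ)) = 1 := by
  have : (fun i : Fin (d + 1) => (WithLp.linearEquiv 2 ℝ (Fin (d + 1) → ℝ))
      (EuclideanSpace.single i (1 : ℝ))) = (1 : Matrix (Fin (d + 1)) (Fin (d + 1)) ℝ) := by
    ext i j
    simp [Matrix.one_apply, eq_comm]
  change Matrix.det (fun i : Fin (d + 1) => (WithLp.linearEquiv 2 ℝ (Fin (d + 1) → ℝ))
      (EuclideanSpace.single i (1 : ℝ))) = 1
  rw [this, Matrix.det_one]

theorem stdVolumeForm_ne_zero : stdVolumeForm d ≠ 0 := fun h => by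
  have := stdVolumeForm_single (d := d)
  rw [h] at this
  simp at this

/-- The value on vertical vectors of the angle form, up to a constant. -/
def angleDet (f : E d → ℝ) (v : E d) (u : Fin d → E d) : ℝ :=
  Matrix.det (Matrix.of (Fin.cons (fun k => fderiv ℝ f v (EuclideanSpace.single k 1))
    fun i k => fderiv ℝ (fderiv ℝ f) v (u i) (EuclideanSpace.single k 1)))

theorem IsMinkowskiNorm.sphereDensity_angleDet {f : E d → ℝ} (hf : IsMinkowskiNorm f) {s : E d}
    (hs : ‖s‖ = 1) : sphereDensity (angleDet f s) s = polarJacobian f s := by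
  have hs0 : s ≠ 0 := by rintro rfl; simp at hs
  rw [hf.polarJacobian_eq hs, ← sum_mul_det_cons_succAbove _ (hf.det_hess hs0)]
  rfl

theorem sphereDensity_const_mul (c : ℝ) (β : (Fin d → E d) → ℝ) (s : E d) :
    sphereDensity (fun u => c * β u) s = c * sphereDensity β s := by
  simp only [sphereDensity, Finset.mul_sum]
  refine Finset.sum_congr rfl fun j _ => ?_
  ring

theorem sphereVolume_pos : 0 < sphereVolume d := by
  rw [sphereVolume, measureReal_def, ENNReal.toReal_pos_iff]
  exact ⟨Measure.measure_univ_pos.2 (Measure.toSphere_ne_zero _), measure_lt_top _ _⟩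

variable {M : Type*} [TopologicalSpace M] [ChartedSpace (E d) M]
  [IsManifold (𝓡 (d + 1)) ∞ M]

theorem dproj_verticalLift (x : M) (v u : E d) :
    dproj (⟨x, v⟩ : TangentBundle (𝓡 (d + 1)) M) (verticalLift x v u) = 0 := by
  rw [verticalLift_apply, dproj_apply]
  rfl

/-- The wedge product with a form pulled back from the base, on vertical vectors. -/
theorem wedge_verticalLift (x : M) (v : E d) (u : Fin d → E d)
    (α : TangentSpace (𝓡 (d + 1)).tangent (⟨x, v⟩ : TangentBundle (𝓡 (d + 1)) M)
      [⋀^Fin d]→ₗ[ℝ] ℝ) (Ω : TangentSpace (𝓡 (d + 1)) x [⋀^Fin (d + 1)]→ₗ[ℝ] ℝ) :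
    wedge α (Ω.compLinearMap (dproj (⟨x, v⟩ : TangentBundle (𝓡 (d + 1)) M)).toLinearMap)
      (Fin.append (fun i => verticalLift x v (u i))
        (fun j => ((EuclideanSpace.single j (1 : ℝ), 0) : E d × E d))) =
      α (fun i => verticalLift x v (u i)) *
        Ω (fun j => (EuclideanSpace.single j (1 : ℝ) : E d)) := by
  refine (wedge_append α _ _ _ ?_).trans ?_
  rotate_left
  · refine congrArg (fun t => α (fun i => verticalLift x v (u i)) * t) ?_
    refine congrArg Ω ?_
    funext j
    exact dproj_apply _ _
  · intro Y i j hY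
    rw [AlternatingMap.compLinearMap_apply]
    refine Ω.map_coord_zero j ?_
    rw [hY]
    exact dproj_verticalLift x v (u i)

namespace IsFinslerMetric

variable {F : TangentBundle (𝓡 (d + 1)) M → ℝ} (hF : IsFinslerMetric F)
include hF

/-- The form `β` is `det (a, b, …, b)`, with `a` the coordinates of `df` and `b` those of the map
from `exists_extDeriv_hilbertForm`. It provides an angle form up to scale and computes every other
one on vertical vectors. -/
theorem exists_contactForm_eq (x : M) {v : E d} (hv : v ≠ 0) :
    ∃ β : TangentSpace (𝓡 (d + 1)).tangent (⟨x, v⟩ : TangentBundle (𝓡 (d + 1)) M)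
        [⋀^Fin d]→ₗ[ℝ] ℝ,
      (∀ u : Fin d → E d, β (fun i => verticalLift x v (u i)) =
        angleDet (fun w => F ⟨x, w⟩) v u) ∧
      ∀ W, contactForm F ⟨x, v⟩ W = shuffleSign d * d.factorial * wedge β
        ((show TangentSpace (𝓡 (d + 1)) x [⋀^Fin (d + 1)]→ₗ[ℝ] ℝ from
          stdVolumeForm d).compLinearMap
            (dproj (⟨x, v⟩ : TangentBundle (𝓡 (d + 1)) M)).toLinearMap) W := by
  obtain ⟨b, hb, hext⟩ := hF.exists_extDeriv_hilbertForm x hv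
  set a : Fin (d + 1) → ℝ := fun k =>
    fderiv ℝ (fun u : E d => F ⟨x, u⟩) v (EuclideanSpace.single k 1) with ha
  let b' : E d × E d →ₗ[ℝ] (Fin (d + 1) → ℝ) := LinearMap.pi fun k =>
    (b.flip (EuclideanSpace.single k 1)).toLinearMap
  let π : E d × E d →ₗ[ℝ] (Fin (d + 1) → ℝ) :=
    (WithLp.linearEquiv 2 ℝ (Fin (d + 1) → ℝ)).toLinearMap ∘ₗ LinearMap.fst ℝ (E d) (E d)
  have hsum : ∀ (ξ : E d →L[ℝ] ℝ) (w : E d),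
      (fun k => ξ (EuclideanSpace.single k 1)) ⬝ᵥ
        (WithLp.linearEquiv 2 ℝ (Fin (d + 1) → ℝ)) w = ξ w := by
    intro ξ w
    conv_rhs => rw [euclidean_sum_single w, map_sum]
    simp [dotProduct, mul_comm]
  refine ⟨borderedDet a b', ?_, ?_⟩
  · intro u
    refine (borderedDet_apply a b' _).trans ?_
    unfold angleDet
    congr 3
    funext i k
    have h1 : verticalLift x v (u i) = ((0, u i) : E d × E d) := verticalLift_apply x v (u i)
    rw [← hb (u i)]
    exact congrArg (fun Z => b' Z k) h1
  · intro W
    refine (wedgeOnePowTwo_eq_wedge (V := E d × E d) a b' π _ _ ?_ ?_ W).trans ?_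
    · intro Z
      refine (hilbertForm_apply F x v Z).trans ?_
      exact (hsum _ Z.1).symm
    · intro Z Y
      refine (hext Z Y).trans ?_
      exact congrArg₂ _ (hsum (b Z) Y.1).symm (hsum (b Y) Z.1).symm
    · congr 2
      ext Y
      change _ = stdVolumeForm d (fun j => dproj (⟨x, v⟩ : TangentBundle (𝓡 (d + 1)) M) (Y j))
      have : (fun j => dproj (⟨x, v⟩ : TangentBundle (𝓡 (d + 1)) M) (Y j)) = fun j => (Y j).1 :=
        funext fun j => dproj_apply _ _
      rw [this]
      rfl

/-- Evaluating the wedge identity on vertical vectors followed by the vectors `(e_j, 0)` isolates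
`α`. The factor `κ` is the same for all `s` because `Ω` lives on the base, so the choice made in
`angleForm` can only affect a constant. -/
theorem exists_sphereDensity_eq {x : M}
    {Ω : TangentSpace (𝓡 (d + 1)) x [⋀^Fin (d + 1)]→ₗ[ℝ] ℝ}
    {α : ∀ v : E d, TangentSpace (𝓡 (d + 1)).tangent (⟨x, v⟩ : TangentBundle (𝓡 (d + 1)) M)
      [⋀^Fin d]→ₗ[ℝ] ℝ} (h : IsVolumeAngle F x Ω α) :
    ∃ κ : ℝ, ∀ s : E d, ‖s‖ = 1 →
      sphereDensity (fun u => α s (fun i => verticalLift x s (u i))) s =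
        κ * polarJacobian (fun w => F ⟨x, w⟩) s := by
  have hΩ : Ω (fun j => (EuclideanSpace.single j (1 : ℝ) : E d)) ≠ 0 := by
    have h1 := (AlternatingMap.map_basis_ne_zero_iff (M := E d)
      (EuclideanSpace.basisFun (Fin (d + 1)) ℝ).toBasis Ω).2 h.volume_ne_zero
    have h2 : ((EuclideanSpace.basisFun (Fin (d + 1)) ℝ).toBasis : Fin (d + 1) → E d) =
        fun j => EuclideanSpace.single j (1 : ℝ) := by
      funext j
      simp
    rw [h2] at h1
    exact h1
  refine ⟨shuffleSign d * d.factorial / Ω (fun j => (EuclideanSpace.single j (1 : ℝ) : E d)),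
    fun s hs => ?_⟩
  have hs0 : s ≠ 0 := by rintro rfl; simp at hs
  obtain ⟨β, hβ, hW⟩ := hF.exists_contactForm_eq x hs0
  rw [← (hF.isMinkowskiNorm x).sphereDensity_angleDet hs, ← sphereDensity_const_mul]
  congr 1
  funext u
  have h1 := h.wedge_eq s hs0 (Fin.append (fun i => verticalLift x s (u i))
        (fun j => ((EuclideanSpace.single j (1 : ℝ), 0) : E d × E d)))
  rw [hW, wedge_verticalLift, wedge_verticalLift, hβ] at h1
  have h2 : (show TangentSpace (𝓡 (d + 1)) x [⋀^Fin (d + 1)]→ₗ[ℝ] ℝ from stdVolumeForm d)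
      (fun j => (EuclideanSpace.single j (1 : ℝ) : E d)) = 1 := stdVolumeForm_single
  rw [h2, mul_one] at h1
  rw [div_mul_eq_mul_div, eq_div_iff hΩ]
  exact h1

/-- Scale `β` by `κ = vol / ∫ J` to meet the normalization and divide the volume form by the same
`κ`, which leaves the wedge product unchanged. -/
theorem exists_isVolumeAngle (x : M) : ∃ α Ω, IsVolumeAngle F x Ω α := by
  have hf := hF.isMinkowskiNorm x
  set f : E d → ℝ := fun w => F ⟨x, w⟩ with hfdef
  set J := ∫ s : Metric.sphere (0 : E d) 1, polarJacobian f s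
    ∂(volume : Measure (E d)).toSphere with hJ
  have hJpos : 0 < J := hf.integral_polarJacobian_pos
  set κ := sphereVolume d / J with hκ
  have hκ0 : 0 < κ := div_pos sphereVolume_pos hJpos
  have hex : ∀ v : E d, ∃ β : TangentSpace (𝓡 (d + 1)).tangent
      (⟨x, v⟩ : TangentBundle (𝓡 (d + 1)) M) [⋀^Fin d]→ₗ[ℝ] ℝ, v ≠ 0 →
      (∀ u : Fin d → E d, β (fun i => verticalLift x v (u i)) = angleDet f v u) ∧
      ∀ W, contactForm F ⟨x, v⟩ W = shuffleSign d * d.factorial * wedge β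
        ((show TangentSpace (𝓡 (d + 1)) x [⋀^Fin (d + 1)]→ₗ[ℝ] ℝ from
          stdVolumeForm d).compLinearMap
            (dproj (⟨x, v⟩ : TangentBundle (𝓡 (d + 1)) M)).toLinearMap) W := by
    intro v
    by_cases hv : v = 0
    · exact ⟨0, fun h => absurd hv h⟩
    · obtain ⟨β, hβ⟩ := hF.exists_contactForm_eq x hv
      exact ⟨β, fun _ => hβ⟩
  choose β hβ using hex
  refine ⟨fun v => κ • β v, (shuffleSign d * d.factorial / κ) • (show TangentSpace (𝓡 (d + 1)) x [⋀^Fin (d + 1)]→ₗ[ℝ] ℝ from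
      stdVolumeForm d), ?_, ?_, ?_⟩
  · have h1 : shuffleSign d * d.factorial / κ ≠ 0 :=
      div_ne_zero (mul_ne_zero (shuffleSign_ne_zero d)
        (Nat.cast_ne_zero.2 (Nat.factorial_ne_zero d))) hκ0.ne'
    have h2 : (shuffleSign d * d.factorial / κ) • stdVolumeForm d ≠ 0 :=
      smul_ne_zero h1 stdVolumeForm_ne_zero
    exact h2
  · intro v hv W
    rw [wedge_smul_compLinearMap_smul, (hβ v hv).2 W, mul_div_cancel₀ _ hκ0.ne']
  · have h1 : ∀ s : Metric.sphere (0 : E d) 1, (1 : ℝ) * sphereDensity (fun u =>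
        (κ • β s) (fun i => verticalLift x (s : E d) (u i)))
          (s : E d) = κ * polarJacobian f s := by
      intro s
      have hs : ‖(s : E d)‖ = 1 := by simp
      have hs0 : (s : E d) ≠ 0 := Metric.ne_of_mem_sphere s.2 one_ne_zero
      rw [one_mul, ← hf.sphereDensity_angleDet hs, ← sphereDensity_const_mul]
      congr 1
      funext u
      rw [AlternatingMap.smul_apply, (hβ s hs0).1, smul_eq_mul]
    refine (integral_congr_ae (Filter.Eventually.of_forall h1)).trans ?_
    rw [integral_const_mul, ← hJ, hκ, div_mul_cancel₀ _ hJpos.ne']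

/-- The unknown constant in the density of the angle form is determined by taking `h = 1` in the
normalization. -/
theorem fiberIntegral_angleForm (x : M) (h : TangentBundle (𝓡 (d + 1)) M → ℝ) :
    fiberIntegral x h (angleForm F x) =
      sphereVolume d / (∫ s : Metric.sphere (0 : E d) 1, polarJacobian (fun w => F ⟨x, w⟩) s
        ∂(volume : Measure (E d)).toSphere) *
      ∫ s : Metric.sphere (0 : E d) 1, h ⟨x, (s : E d)⟩ * polarJacobian (fun w => F ⟨x, w⟩) s
        ∂(volume : Measure (E d)).toSphere := by
  have hf := hF.isMinkowskiNorm x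
  obtain ⟨Ω, hΩ⟩ : ∃ Ω, IsVolumeAngle F x Ω (angleForm F x) :=
    Classical.epsilon_spec (hF.exists_isVolumeAngle x)
  obtain ⟨κ, hκ⟩ := hF.exists_sphereDensity_eq hΩ
  have h1 : ∀ h : TangentBundle (𝓡 (d + 1)) M → ℝ, fiberIntegral x h (angleForm F x) =
      κ * ∫ s : Metric.sphere (0 : E d) 1, h ⟨x, (s : E d)⟩ *
        polarJacobian (fun w => F ⟨x, w⟩) s ∂(volume : Measure (E d)).toSphere := by
    intro h
    rw [fiberIntegral, ← integral_const_mul]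
    refine integral_congr_ae (Filter.Eventually.of_forall fun s => ?_)
    simp only [hκ (s : E d) (by simp)]
    ring
  have h2 := hΩ.integral_eq
  rw [h1] at h2
  simp only [one_mul] at h2
  rw [h1, ← h2, mul_div_cancel_right₀ _ hf.integral_polarJacobian_pos.ne']

/-- The symbol of the Finsler-Laplacian. -/
theorem isSymbol_finslerLaplacian : IsSymbol (finslerLaplacian F) fun x p =>
    ((d + 1 : ℕ) : ℝ) / (∫ s : Metric.sphere (0 : E d) 1, polarJacobian (fun w => F ⟨x, w⟩) s
        ∂(volume : Measure (E d)).toSphere) *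
      ∫ s : Metric.sphere (0 : E d) 1, (p (s : E d) / F ⟨x, (s : E d)⟩) ^ 2 *
        polarJacobian (fun w => F ⟨x, w⟩) s ∂(volume : Measure (E d)).toSphere := by
  intro x φ hφ hφx
  rw [finslerLaplacian, hF.fiberIntegral_angleForm]
  let p : E d →L[ℝ] ℝ := mfderiv (𝓡 (d + 1)) 𝓘(ℝ, ℝ) φ x
  have h1 : ∀ s : Metric.sphere (0 : E d) 1,
      lieReeb F (lieReeb F (fun q : TangentBundle (𝓡 (d + 1)) M => φ q.1 ^ 2)) ⟨x, (s : E d)⟩ *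
        polarJacobian (fun w => F ⟨x, w⟩) s = 2 * ((p (s : E d) / F ⟨x, (s : E d)⟩) ^ 2 *
        polarJacobian (fun w => F ⟨x, w⟩) s) := by
    intro s
    rw [hF.lieReeb_lieReeb_sq (p := p) hφ hφx rfl (Metric.ne_of_mem_sphere s.2 one_ne_zero),
      mul_assoc]
    rfl
  simp only [h1]
  rw [integral_const_mul]
  change ((d + 1 : ℕ) : ℝ) / _ * ∫ s : Metric.sphere (0 : E d) 1,
    (p (s : E d) / F ⟨x, (s : E d)⟩) ^ 2 * polarJacobian (fun w => F ⟨x, w⟩) s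
      ∂(volume : Measure (E d)).toSphere = _
  have := (sphereVolume_pos (d := d)).ne'
  field_simp

end IsFinslerMetric

end

/-! ### Comparison with the dual norm -/

section

open MeasureTheory

variable {d : ℕ}

/-- The supremum of a linear form over the unit sphere of a Euclidean structure `g`. -/
theorem sSup_unit_vectors_spec (g : E d →L[ℝ] E d →L[ℝ] ℝ) (hg : ∀ v, v ≠ 0 → 0 < g v v)
    {f : E d → ℝ} (hf : IsMinkowskiNorm f) {C : ℝ} (hup : ∀ v, f v ≤ C * √(g v v))
    {p : E d →L[ℝ] ℝ} (hp : p ≠ 0) :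
    0 < sSup {t : ℝ | ∃ v, g v v = 1 ∧ t = p v} ∧
    (∀ v, p v ≤ sSup {t : ℝ | ∃ v, g v v = 1 ∧ t = p v} * √(g v v)) ∧
    ∀ c, c < sSup {t : ℝ | ∃ v, g v v = 1 ∧ t = p v} → ∃ u, 0 < √(g u u) ∧ c * √(g u u) < p u := by
  set S := {t : ℝ | ∃ v, g v v = 1 ∧ t = p v} with hS
  obtain ⟨w, hw⟩ : ∃ w, 0 < p w := by
    by_contra hcon
    push Not at hcon
    refine hp (ContinuousLinearMap.ext fun w => le_antisymm (hcon w) ?_)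
    have := hcon (-w)
    rw [map_neg] at this
    simpa using this
  have hw0 : w ≠ 0 := by rintro rfl; simp at hw
  have hunit : ∀ v, v ≠ 0 → p v / √(g v v) ∈ S := by
    intro v hv
    have h1 := Real.sqrt_pos.2 (hg v hv)
    refine ⟨(√(g v v))⁻¹ • v, ?_, ?_⟩
    · simp only [map_smul, _root_.smul_apply, smul_eq_mul]
      rw [← mul_assoc, ← mul_inv, Real.mul_self_sqrt (hg v hv).le, inv_mul_cancel₀ (hg v hv).ne']
    · rw [map_smul, smul_eq_mul, inv_mul_eq_div]
  -- Write `p` as `‖v‖ df_v`; then `p(u) ≤ ‖v‖ f(u) ≤ ‖v‖ C` on `g`-unit vectors.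
  have hbdd : BddAbove S := by
    obtain ⟨v, hv, hvp⟩ := hf.exists_polarMap_eq (ξ := dualVec d p) ⟨w, by rwa [inner_dualVec]⟩
    refine ⟨‖v‖ * C, ?_⟩
    rintro t ⟨u, hu, rfl⟩
    rw [← inner_dualVec, ← hvp, inner_polarMap]
    refine mul_le_mul_of_nonneg_left ((hf.fderiv_le hv u).trans ?_) (norm_nonneg v)
    simpa [hu] using hup u
  have hle : ∀ v, p v ≤ sSup S * √(g v v) := by
    intro v
    by_cases hv : v = 0
    · simp [hv]
    · rw [← div_le_iff₀ (Real.sqrt_pos.2 (hg v hv))]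
      exact le_csSup hbdd (hunit v hv)
  refine ⟨?_, hle, ?_⟩
  · exact lt_of_lt_of_le (div_pos hw (Real.sqrt_pos.2 (hg w hw0))) (le_csSup hbdd (hunit w hw0))
  · intro c hc
    obtain ⟨t, ⟨u, hu, rfl⟩, ht⟩ := exists_lt_of_lt_csSup ⟨_, hunit w hw0⟩ hc
    exact ⟨u, by simp [hu], by simpa [hu] using ht⟩

/-- Comparison of the quadratic form `p ↦ ∫ (p / f)² / ∫ 1` with the norm dual to `g`. -/
theorem IsMinkowskiNorm.sqrt_symbol_bounds {f : E d → ℝ} (hf : IsMinkowskiNorm f) {C : ℝ}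
    (hC : 1 < C) (g : E d →L[ℝ] E d →L[ℝ] ℝ) (hg : ∀ v, v ≠ 0 → 0 < g v v)
    (hfg : ∀ v, v ≠ 0 → C⁻¹ ≤ f v / √(g v v) ∧ f v / √(g v v) ≤ C)
    {p : E d →L[ℝ] ℝ} (hp : p ≠ 0) :
    √(((d + 1 : ℕ) : ℝ) * ((1 / (2 * C)) ^ 2 * (1 / (16 * C ^ 4)) ^ (d + 1))) ≤
      √(((d + 1 : ℕ) : ℝ) / (∫ s : Metric.sphere (0 : E d) 1, polarJacobian f s
        ∂(volume : Measure (E d)).toSphere) *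
      ∫ s : Metric.sphere (0 : E d) 1, (p (s : E d) / f (s : E d)) ^ 2 *
        polarJacobian f s ∂(volume : Measure (E d)).toSphere) /
          sSup {t : ℝ | ∃ v, g v v = 1 ∧ t = p v} ∧
    √(((d + 1 : ℕ) : ℝ) / (∫ s : Metric.sphere (0 : E d) 1, polarJacobian f s
        ∂(volume : Measure (E d)).toSphere) *
      ∫ s : Metric.sphere (0 : E d) 1, (p (s : E d) / f (s : E d)) ^ 2 *
        polarJacobian f s ∂(volume : Measure (E d)).toSphere) /
          sSup {t : ℝ | ∃ v, g v v = 1 ∧ t = p v} ≤ √(((d + 1 : ℕ) : ℝ) * C ^ 2) := by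
  have hC0 : 0 < C := by linarith
  have hup : ∀ v, f v ≤ C * √(g v v) := by
    intro v
    by_cases hv : v = 0
    · simp [hv, hf.map_zero]
    · exact (div_le_iff₀ (Real.sqrt_pos.2 (hg v hv))).1 (hfg v hv).2
  have hlow : ∀ v, √(g v v) ≤ C * f v := by
    intro v
    by_cases hv : v = 0
    · simp [hv, hf.map_zero]
    · have := (le_div_iff₀ (Real.sqrt_pos.2 (hg v hv))).1 (hfg v hv).1
      rwa [inv_mul_le_iff₀ hC0] at this
  have hneg : ∀ v, √(g (-v) (-v)) = √(g v v) := by simp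
  obtain ⟨hq, hpq, hattain⟩ := sSup_unit_vectors_spec g hg hf hup hp
  set q := sSup {t : ℝ | ∃ v, g v v = 1 ∧ t = p v}
  have h1 := hf.le_integral_ratio hC hlow hup hneg (fun v hv => Real.sqrt_pos.2 (hg v hv)) hq hpq
    hattain
  have h2 := hf.integral_ratio_le hlow hneg hq hpq
  have hJ := hf.integral_polarJacobian_pos
  set J := ∫ s : Metric.sphere (0 : E d) 1, polarJacobian f s ∂(volume : Measure (E d)).toSphere
  set Q := ∫ s : Metric.sphere (0 : E d) 1, (p (s : E d) / f (s : E d)) ^ 2 *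
    polarJacobian f s ∂(volume : Measure (E d)).toSphere
  have hn : (0 : ℝ) < ((d + 1 : ℕ) : ℝ) := by positivity
  have hqd : √(((d + 1 : ℕ) : ℝ) / J * Q) / q = √(((d + 1 : ℕ) : ℝ) * (Q / (J * q ^ 2))) := by
    rw [← Real.sqrt_sq hq.le, ← Real.sqrt_div' _ (sq_nonneg q), Real.sqrt_sq hq.le]
    congr 1
    field_simp
  rw [hqd]
  constructor
  · refine Real.sqrt_le_sqrt (mul_le_mul_of_nonneg_left ?_ hn.le)
    rw [le_div_iff₀ (by positivity)]
    refine le_trans (le_of_eq ?_) h1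
    ring
  · refine Real.sqrt_le_sqrt (mul_le_mul_of_nonneg_left ?_ hn.le)
    rw [div_le_iff₀ (by positivity)]
    refine le_trans h2 (le_of_eq ?_)
    ring

end

end Finsler

end

/-! ### The comparison theorem -/

theorem proposition3p4 (d : ℕ) (C : ℝ) (hC : 1 < C) :
    ∃ K : ℝ, 1 ≤ K ∧
      ∀ (M : Type*) [TopologicalSpace M] [ChartedSpace (EuclideanSpace ℝ (Fin (d + 1))) M]
        [IsManifold (𝓡 (d + 1)) ∞ M]
        (F : TangentBundle (𝓡 (d + 1)) M → ℝ)
        (g₀ : Bundle.ContMDiffRiemannianMetric (𝓡 (d + 1)) ∞ (EuclideanSpace ℝ (Fin (d + 1)))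
          (fun x : M => TangentSpace (𝓡 (d + 1)) x)),
        Finsler.IsFinslerMetric F →
        (∀ (x : M) (v : TangentSpace (𝓡 (d + 1)) x), v ≠ 0 →
          C⁻¹ ≤ F ⟨x, v⟩ / √(g₀.inner x v v) ∧ F ⟨x, v⟩ / √(g₀.inner x v v) ≤ C) →
        ∃ σ : ∀ x : M, (TangentSpace (𝓡 (d + 1)) x →L[ℝ] ℝ) → ℝ,
          Finsler.IsSymbol (Finsler.finslerLaplacian F) σ ∧
          ∀ (x : M) (p : TangentSpace (𝓡 (d + 1)) x →L[ℝ] ℝ), p ≠ 0 →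
            C ^ (-K) ≤ √(σ x p) / Finsler.dualNorm g₀ x p ∧
              √(σ x p) / Finsler.dualNorm g₀ x p ≤ C ^ K := by
  have hC0 : 0 < C := by linarith
  set lo := √(((d + 1 : ℕ) : ℝ) * ((1 / (2 * C)) ^ 2 * (1 / (16 * C ^ 4)) ^ (d + 1))) with hlo
  set up := √(((d + 1 : ℕ) : ℝ) * C ^ 2) with hup
  have hlo0 : 0 < lo := Real.sqrt_pos.2 (by positivity)
  have hup0 : 0 < up := Real.sqrt_pos.2 (by positivity)
  -- The bounds `lo` and `up` depend only on `d` and `C`; as `C > 1`, logarithms to base `C` turn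
  -- them into powers of `C`.
  set K := max 1 (max (Real.logb C up) (-Real.logb C lo)) with hK
  have hK1 : Real.logb C up ≤ K := (le_max_left _ _).trans (le_max_right _ _)
  have hK2 : -K ≤ Real.logb C lo := by
    have : -Real.logb C lo ≤ K := (le_max_right _ _).trans (le_max_right _ _)
    linarith
  have hCup : up ≤ C ^ K := by
    rw [← Real.logb_le_iff_le_rpow hC hup0]
    exact hK1
  have hClo : C ^ (-K) ≤ lo := by
    rw [← Real.le_logb_iff_rpow_le hC hlo0]
    exact hK2
  refine ⟨K, le_max_left _ _, ?_⟩
  intro M _ _ _ F g₀ hF hFg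
  refine ⟨_, hF.isSymbol_finslerLaplacian, fun x p hp => ?_⟩
  have key := (hF.isMinkowskiNorm x).sqrt_symbol_bounds hC (g₀.inner x) (g₀.pos x) (hFg x)
    (p := p) hp
  exact ⟨hClo.trans key.1, key.2.trans hCup⟩
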